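/- Let $1\le r\le\infty$, let $\mathcal O$ be a compact and $\mathcal P$ an arbitrary (effective, paracompact Hausdorff) $C^{r+1}$ orbifold without boundary, of dimensions $n$ and $m$, with charts $(\tilde U_x,\Gamma_x)$ at $x\in\mathcal O$ and $(\tilde V_z,\Gamma_z)$ at $z\in\mathcal P$ and chart embeddings $\tilde\psi_{zx}$, equivariant with respect to injective homomorphisms $\theta_{zx}:\Gamma_z\to\Gamma_x$. Let ${}_\star f=(f,\{\tilde f_x\},\{\Theta_{f,x}\})$ be a $C^{r+1}$ complete orbifold map $\mathcal O\to\mathcal P$: a continuous map $f$ together with homomorphisms $\Theta_{f,x}:\Gamma_x\to\Gamma_{f(x)}$ and $\Theta_{f,x}$-equivariant $C^{r+1}$ lifts $\tilde f_x:\tilde U_x\to\tilde V_{f(x)}$ of $f$ (after shrinking $\tilde U_x$). Its pullback orbibundle ${}_\star f^*(T\mathcal P)\to\mathcal O$ has the charts $\tilde U_x\times_{\tilde V_{f(x)}}T\tilde V_{f(x)}\cong\tilde U_x\times\mathbb R^m$ with the actions $\gamma\cdot(\tilde y,\tilde v)=(\gamma\cdot\tilde y,\,d(\Theta_{f,x}(\gamma))_{\tilde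 f_x(\tilde y)}\tilde v)$ of $\Gamma_x$, glued by $(\tilde y,\tilde v)\mapsto(\tilde\psi_{zx}(\tilde y),\,d(\eta_{zx})_{\tilde f_z(\tilde y)}\tilde v)$; here $\eta_{zx}=\varepsilon_{zx}\cdot\tilde\psi_{f(z)f(x)}$ with $\varepsilon_{zx}\in\Gamma_{f(x)}$ are given chart changes of $\mathcal P$ along $f$, that is, near the respective base points $\tilde f_x\circ\tilde\psi_{zx}=\eta_{zx}\circ\tilde f_z$, $\ \Theta_{f,x}(\theta_{zx}(\gamma))\,\varepsilon_{zx}=\varepsilon_{zx}\,\theta_{f(z)f(x)}(\Theta_{f,z}(\gamma))$, and $\eta_{zx}\circ\eta_{wz}=\Theta_{f,x}(\delta)\cdot\eta_{wx}$ where $\delta\in\Gamma_x$ is such that $\tilde\psi_{zx}\circ\tilde\psi_{wz}=\delta\cdot\tilde\psi_{wx}$. Let $\mathscr D^r_{\mathrm{Orb}}({}_\star f^*(T\mathcal P))$ be the set of $C^r$ orbisections of this bundle: the $C^r$ orbifold maps $\sigma:\mathcal O\to{}_\star f^*(T\mathcal P)$ over the identity whose lifts have the form $\tilde\sigma_x(\tilde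 y)=(\tilde y,\tilde s_x(\tilde y))$. Give it the topology induced by the inclusion into the set $C^r_{\mathrm{Orb}}(\mathcal O,{}_\star f^*(T\mathcal P))$ of $C^r$ orbifold maps with the $C^r$ topology (uniform closeness of the derivatives of order at most $r$ of the lifts over compact subsets of charts; all finite orders if $r=\infty$). Then, with the operations $\tilde s_x\mapsto\tilde s_x+\tilde t_x$ and $\tilde s_x\mapsto a\tilde s_x$ on lifts, $\mathscr D^r_{\mathrm{Orb}}({}_\star f^*(T\mathcal P))$ is a topological vector space, and it is a separable Banach space if $r<\infty$ and a separable Fréchet space if $r=\infty$. Moreover there are finitely many invariant compact subsets $\tilde C_1,\dots,\tilde C_N$ of charts of $\mathcal O$, each the closure of its interior, whose images cover $\mathcal O$, such that $\sigma\mapsto(\tilde s_i|_{\tilde C_i})_{i}$ is a linear homeomorphism of $\mathscr D^r_{\mathrm{Orb}}({}_\star f^*(T\mathcal P))$ onto a closed subspace of $\bigoplus_{i=1}^N C^r(\tilde C_i,\mathbb R^m)$, where $C^r(\tilde C_i,\mathbb R^m)$ carries the topology of uniform convergence of all derivatives of order $\le r$. -/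

import Mathlib

open Set Filter Topology

/-- The model space `ℝⁿ`. -/
abbrev Eu (n : ℕ) : Type := EuclideanSpace ℝ (Fin n)

/-- A `C^k` orbifold chart `(Ũ_x, Γ_x, ρ_x, φ_x)` at `x`: a connected open set `Ũ_x = dom ⊆ ℝⁿ`, a
finite group `Γ_x` acting effectively on it by `C^k` maps and fixing the point `x̃ = center`, and a
map `proj : Ũ_x → X` over `x` which induces a homeomorphism `φ_x` of `Ũ_x / Γ_x` onto an open
subset `U_x` of `X` (it is continuous and open, and its fibres are the orbits). Values of `act`
and `proj` outside `dom` carry no meaning. -/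
structure OrbifoldChart (n : ℕ) (k : ℕ∞) (X : Type*) [TopologicalSpace X] (x : X) where
  dom : Set (Eu n)
  isOpen_dom : IsOpen dom
  isConnected_dom : IsConnected dom
  Γ : Type
  [group : Group Γ]
  [finite : Finite Γ]
  act : Γ → Eu n → Eu n
  mapsTo_act : ∀ γ, MapsTo (act γ) dom dom
  act_one : ∀ y ∈ dom, act 1 y = y
  act_mul : ∀ γ δ, ∀ y ∈ dom, act (γ * δ) y = act γ (act δ y)
  contDiffOn_act : ∀ γ, ContDiffOn ℝ (k : WithTop ℕ∞) (act γ) dom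
  effective : ∀ γ, (∀ y ∈ dom, act γ y = y) → γ = 1
  proj : Eu n → X
  continuousOn_proj : ContinuousOn proj dom
  isOpen_image_proj : ∀ V ⊆ dom, IsOpen V → IsOpen (proj '' V)
  proj_eq_iff : ∀ y ∈ dom, ∀ y' ∈ dom, proj y = proj y' ↔ ∃ γ, act γ y = y'
  center : Eu n
  center_mem : center ∈ dom
  act_center : ∀ γ, act γ center = center
  proj_center : proj center = x

attribute [instance] OrbifoldChart.group OrbifoldChart.finite

/-- A smaller orbifold chart at `x` with the same group: a connected open invariant neighbourhood
`W` of `x̃` in `Ũ_x` on which `Γ_x` acts effectively. -/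
structure OrbifoldChart.IsSubchart {n : ℕ} {k : ℕ∞} {X : Type*} [TopologicalSpace X] {x : X}
    (c : OrbifoldChart n k X x) (W : Set (Eu n)) : Prop where
  isOpen : IsOpen W
  isConnected : IsConnected W
  subset_dom : W ⊆ c.dom
  center_mem : c.center ∈ W
  mapsTo_act : ∀ γ, MapsTo (c.act γ) W W
  effective : ∀ γ, (∀ y ∈ W, c.act γ y = y) → γ = 1

/-- A `C^k` orbifold structure of dimension `n` on `X`: an orbifold chart at each point `x`, and for
`z ∈ U_x` an open `C^k` embedding `ψ̃_zx = ψ z x` of an invariant neighbourhood of `z̃` in `Ũ_z`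
(a smaller chart at `z`) into `Ũ_x`, which covers the inclusion and is equivariant with respect to
an injective homomorphism `θ_zx = θ z x : Γ_z → Γ_x`. For `z ∉ U_x` the values `ψ z x` and `θ z x`
carry no meaning. -/
structure Orbifold (n : ℕ) (k : ℕ∞) (X : Type*) [TopologicalSpace X] where
  chart : ∀ x : X, OrbifoldChart n k X x
  ψ : X → X → OpenPartialHomeomorph (Eu n) (Eu n)
  θ : ∀ z x : X, (chart z).Γ →* (chart x).Γ
  center_mem_source : ∀ z x, z ∈ (chart x).proj '' (chart x).dom →
    (chart z).center ∈ (ψ z x).source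
  source_subset : ∀ z x, z ∈ (chart x).proj '' (chart x).dom → (ψ z x).source ⊆ (chart z).dom
  target_subset : ∀ z x, z ∈ (chart x).proj '' (chart x).dom → (ψ z x).target ⊆ (chart x).dom
  contDiffOn_ψ : ∀ z x, z ∈ (chart x).proj '' (chart x).dom →
    ContDiffOn ℝ (k : WithTop ℕ∞) (ψ z x) (ψ z x).source
  contDiffOn_ψ_symm : ∀ z x, z ∈ (chart x).proj '' (chart x).dom →
    ContDiffOn ℝ (k : WithTop ℕ∞) (ψ z x).symm (ψ z x).target
  proj_ψ : ∀ z x, z ∈ (chart x).proj '' (chart x).dom →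
    ∀ y ∈ (ψ z x).source, (chart x).proj (ψ z x y) = (chart z).proj y
  mapsTo_act_source : ∀ z x, z ∈ (chart x).proj '' (chart x).dom →
    ∀ γ, MapsTo ((chart z).act γ) (ψ z x).source (ψ z x).source
  ψ_act : ∀ z x, z ∈ (chart x).proj '' (chart x).dom → ∀ γ, ∀ y ∈ (ψ z x).source,
    ψ z x ((chart z).act γ y) = (chart x).act (θ z x γ) (ψ z x y)
  injective_θ : ∀ z x, z ∈ (chart x).proj '' (chart x).dom → Function.Injective (θ z x)

section CompleteMaps

variable {n m : ℕ} {k : ℕ∞} {X Y : Type*} [TopologicalSpace X] [TopologicalSpace Y]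

/-- A (representative of a) `C^k` complete orbifold map `(f, {f̃_x}, {Θ_{f,x}})`: a continuous map
`f`, homomorphisms `Θ_{f,x} : Γ_x → Γ_{f(x)}`, and on a chart `W_x = dom x ⊆ Ũ_x` at each `x` a
`Θ_{f,x}`-equivariant `C^k` lift `f̃_x : W_x → Ṽ_{f(x)}` of `f`. -/
structure CompleteOrbifoldMap (O : Orbifold n k X) (P : Orbifold m k Y) where
  toFun : X → Y
  continuous_toFun : Continuous toFun
  Θ : ∀ x, (O.chart x).Γ →* (P.chart (toFun x)).Γ
  dom : X → Set (Eu n)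
  isSubchart_dom : ∀ x, (O.chart x).IsSubchart (dom x)
  lift : X → Eu n → Eu m
  mapsTo_lift : ∀ x, MapsTo (lift x) (dom x) (P.chart (toFun x)).dom
  contDiffOn_lift : ∀ x, ContDiffOn ℝ (k : WithTop ℕ∞) (lift x) (dom x)
  lift_act : ∀ x γ, ∀ y ∈ dom x,
    lift x ((O.chart x).act γ y) = (P.chart (toFun x)).act (Θ x γ) (lift x y)
  proj_lift : ∀ x, ∀ y ∈ dom x,
    (P.chart (toFun x)).proj (lift x y) = toFun ((O.chart x).proj y)

namespace CompleteOrbifoldMap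

variable {O : Orbifold n k X} {P : Orbifold m k Y}

/-- The open subset of `X` covered by the chart `W_x` on which `f̃_x` is defined. -/
def base (f : CompleteOrbifoldMap O P) (x : X) : Set X := (O.chart x).proj '' f.dom x

/-- The chart change `η_zx = ε · ψ̃_{f(z)f(x)}` from `Ṽ_{f(z)}` to `Ṽ_{f(x)}`, where `ε ∈ Γ_{f(x)}`. -/
def changeOf (f : CompleteOrbifoldMap O P) (z x : X) (ε : (P.chart (f.toFun x)).Γ) :
    Eu m → Eu m :=
  fun u => (P.chart (f.toFun x)).act ε (P.ψ (f.toFun z) (f.toFun x) u)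

/-- The transition data along which the charts `W_x ×_{Ṽ_{f(x)}} TṼ_{f(x)}` of the pullback of the
tangent orbibundle are glued to an orbibundle. As chart changes are only determined up to the
local groups, it is a choice, for `z ∈ U_x`, of a chart change `η_zx = ε_zx · ψ̃_{f(z)f(x)}` with
`f̃_x ∘ ψ̃_zx = η_zx ∘ f̃_z`, compatible with the homomorphisms `Θ`, and coherent: whenever
`ψ̃_zx ∘ ψ̃_wz = δ · ψ̃_wx`, also `η_zx ∘ η_wz = Θ_{f,x}(δ) · η_wx`. -/
structure Transitions (f : CompleteOrbifoldMap O P) where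
  ε : ∀ _z x : X, (P.chart (f.toFun x)).Γ
  lift_ψ : ∀ z x, z ∈ f.base x → ∀ᶠ y in 𝓝 (O.chart z).center,
    f.lift x (O.ψ z x y) = f.changeOf z x (ε z x) (f.lift z y)
  Θ_θ : ∀ z x, z ∈ f.base x → ∀ γ,
    f.Θ x (O.θ z x γ) * ε z x = ε z x * P.θ (f.toFun z) (f.toFun x) (f.Θ z γ)
  cocycle : ∀ z x, z ∈ f.base x → ∀ᶠ y in 𝓝 (O.chart z).center, ∀ w, w = (O.chart z).proj y →
    ∃ δ : (O.chart x).Γ,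
      (∀ᶠ u in 𝓝 (O.chart w).center,
        O.ψ z x (O.ψ w z u) = (O.chart x).act δ (O.ψ w x u)) ∧
      (∀ᶠ u in 𝓝 (P.chart (f.toFun w)).center,
        f.changeOf z x (ε z x) (f.changeOf w z (ε w z) u) =
          (P.chart (f.toFun x)).act (f.Θ x δ) (f.changeOf w x (ε w x) u))

namespace Transitions

variable {f : CompleteOrbifoldMap O P} (T : f.Transitions)

/-- The chart change `η_zx` of the target. -/
def η (z x : X) : Eu m → Eu m := f.changeOf z x (T.ε z x)

/-- The action of `Γ_x` on the chart `W_x ×_{Ṽ_{f(x)}} TṼ_{f(x)}` of the pullback, in the coordinates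
`(ỹ, v) ↔ (ỹ, [f̃_x(ỹ), v])` that identify this chart with `W_x × ℝᵐ`:
`γ · (ỹ, v) = (γ · ỹ, d(Θ_{f,x}(γ))_{f̃_x(ỹ)} v)`. -/
noncomputable def bundleAct (_T : f.Transitions) (x : X) (γ : (O.chart x).Γ) (q : Eu n × Eu m) :
    Eu n × Eu m :=
  ((O.chart x).act γ q.1,
    fderiv ℝ ((P.chart (f.toFun x)).act (f.Θ x γ)) (f.lift x q.1) q.2)

/-- The chart change `(ỹ, v) ↦ (ψ̃_zx(ỹ), d(η_zx)_{f̃_z(ỹ)} v)` of the pullback. -/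
noncomputable def bundleψ (z x : X) (q : Eu n × Eu m) : Eu n × Eu m :=
  (O.ψ z x q.1, fderiv ℝ (T.η z x) (f.lift z q.1) q.2)

/-- The disjoint union of the charts `W_x × ℝᵐ` of the pullback. -/
abbrev Pre (_T : f.Transitions) : Type _ := Σ x : X, (f.dom x) × Eu m

/-- The identifications in the disjoint union of the charts: by the groups `Γ_x`, and of the fibre
over `w̃` in the chart at `w` with a fibre in the chart at `x` by the chart change, for `w ∈ U_x`.
Every point over `w` in the chart at `x` is in the `Γ_x`-orbit of `ψ̃_wx(w̃)`. -/
inductive Rel : T.Pre → T.Pre → Prop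
  | act (x : X) (γ : (O.chart x).Γ) (y y' : f.dom x) (v v' : Eu m)
      (h : ((y' : Eu n), v') = T.bundleAct x γ ((y : Eu n), v)) : Rel ⟨x, (y, v)⟩ ⟨x, (y', v')⟩
  | change (w x : X) (hw : w ∈ f.base x) (y : f.dom w) (y' : f.dom x) (v v' : Eu m)
      (hy : (y : Eu n) = (O.chart w).center)
      (h : ((y' : Eu n), v') = T.bundleψ w x ((y : Eu n), v)) : Rel ⟨w, (y, v)⟩ ⟨x, (y', v')⟩

/-- The underlying space of the pullback orbibundle `f^*(TP)`, with the quotient topology. -/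
def Total : Type _ := Quot T.Rel

instance : TopologicalSpace T.Total := inferInstanceAs (TopologicalSpace (Quot T.Rel))

/-- The quotient map `Π_x : W_x × ℝᵐ → f^*(TP)`. -/
def toTotal (x : X) (q : Eu n × Eu m) (h : q.1 ∈ f.dom x) : T.Total :=
  Quot.mk T.Rel ⟨x, (⟨q.1, h⟩, q.2)⟩

/-- The orbibundle projection `p : f^*(TP) → O`. -/
def bundleProj : T.Total → X :=
  Quot.lift (fun q : T.Pre => (O.chart q.1).proj (q.2.1 : Eu n)) <| by
    intro a b hab
    cases hab with
    | act x γ y y' v v' h =>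
      have h1 : (y' : Eu n) = (O.chart x).act γ y := congrArg Prod.fst h
      exact ((O.chart x).proj_eq_iff _ ((f.isSubchart_dom x).subset_dom y.2) _
        ((f.isSubchart_dom x).subset_dom y'.2)).2 ⟨γ, h1.symm⟩
    | change w x hw y y' v v' hy h =>
      have h1 : (y' : Eu n) = O.ψ w x y := congrArg Prod.fst h
      have hw' : w ∈ (O.chart x).proj '' (O.chart x).dom :=
        image_mono (f.isSubchart_dom x).subset_dom hw
      have hs : (y : Eu n) ∈ (O.ψ w x).source := hy ▸ O.center_mem_source w x hw'
      change (O.chart w).proj (y : Eu n) = (O.chart x).proj (y' : Eu n)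
      rw [h1, O.proj_ψ w x hw' _ hs]

/-- The points of the chart at `z` near which `bundleψ z x` is a chart change of the pullback, that
is, covers the identity of its underlying space. -/
def changeDom (z x : X) : Set (Eu n) :=
  {y | y ∈ (O.ψ z x).source ∧ f.lift z y ∈ (P.ψ (f.toFun z) (f.toFun x)).source ∧
    z ∈ f.base x ∧
    ∀ᶠ u in 𝓝 y, ∃ (h : u ∈ f.dom z) (h' : O.ψ z x u ∈ f.dom x), ∀ v : Eu m,
      T.toTotal z (u, v) h = T.toTotal x (T.bundleψ z x (u, v)) h'}

/-- A representative of a `C^r` orbifold map `(g, {g̃_x})` from `O` to the pullback orbibundle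
`f^*(TP)`: a continuous map `g` and, on some chart at each `x`, a `C^r` lift `g̃_x` to the chart of
`f^*(TP)` over the point `p(g(x))`, equivariant with respect to some homomorphism. -/
structure MapRep (r : ℕ∞) where
  toFun : X → T.Total
  continuous_toFun : Continuous toFun
  dom : X → Set (Eu n)
  isSubchart_dom : ∀ x, (O.chart x).IsSubchart (dom x)
  lift : X → Eu n → Eu n × Eu m
  mapsTo_lift : ∀ x, ∀ y ∈ dom x, (lift x y).1 ∈ f.dom (T.bundleProj (toFun x))
  contDiffOn_lift : ∀ x, ContDiffOn ℝ (r : WithTop ℕ∞) (lift x) (dom x)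
  toTotal_lift : ∀ x, ∀ y, ∀ hy : y ∈ dom x,
    T.toTotal _ (lift x y) (mapsTo_lift x y hy) = toFun ((O.chart x).proj y)
  equivariant : ∀ x, ∃ Θ' : (O.chart x).Γ →* (O.chart (T.bundleProj (toFun x))).Γ,
    ∀ γ, ∀ y ∈ dom x, lift x ((O.chart x).act γ y) = T.bundleAct _ (Θ' γ) (lift x y)

/-- Two orbifold maps are equal if they have the same lifts at each `x`, as germs at `x̃`. -/
def mapSetoid (r : ℕ∞) : Setoid (T.MapRep r) where
  r g g' := g.toFun = g'.toFun ∧ ∀ x, g.lift x =ᶠ[𝓝 (O.chart x).center] g'.lift x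
  iseqv :=
    { refl := fun _ => ⟨rfl, fun _ => EventuallyEq.rfl⟩
      symm := fun h => ⟨h.1.symm, fun x => (h.2 x).symm⟩
      trans := fun h h' => ⟨h.1.trans h'.1, fun x => (h.2 x).trans (h'.2 x)⟩ }

/-- The set `C^r_Orb(O, f^*(TP))` of `C^r` orbifold maps. -/
def OrbMap (r : ℕ∞) : Type _ := Quotient (T.mapSetoid r)

/-- The subbasic `C^r` neighbourhood of the orbifold map `g₀`: the orbifold maps `g` such that, over
the compact subset `K` of a chart at `x`, the lifts of `g₀` and `g` at `x` can be transferred to the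
chart of `f^*(TP)` over `z`, and there differ by less than `ε` in all derivatives of order at most
`s`. -/
def mapNhd {r : ℕ∞} (g₀ : T.MapRep r) (x z : X) (K : Set (Eu n)) (s : ℕ) (ε : ℝ) :
    Set (T.OrbMap r) :=
  {q | ∃ g : T.MapRep r, Quotient.mk (T.mapSetoid r) g = q ∧ K ⊆ g.dom x ∧
    (∀ y ∈ K, (g.lift x y).1 ∈ T.changeDom (T.bundleProj (g.toFun x)) z) ∧
    ∀ j ≤ s, ∀ y ∈ K,
      ‖iteratedFDeriv ℝ j (fun u => T.bundleψ (T.bundleProj (g.toFun x)) z (g.lift x u)) y -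
        iteratedFDeriv ℝ j (fun u => T.bundleψ (T.bundleProj (g₀.toFun x)) z (g₀.lift x u)) y‖
        < ε}

/-- The `C^r` topology on `C^r_Orb(O, f^*(TP))`, generated by the neighbourhoods above with finite
orders `s ≤ r`. -/
instance (r : ℕ∞) : TopologicalSpace (T.OrbMap r) :=
  TopologicalSpace.generateFrom
    {N | ∃ (g₀ : T.MapRep r) (x z : X) (K : Set (Eu n)) (s : ℕ) (ε : ℝ),
      IsCompact K ∧ K ⊆ g₀.dom x ∧
      (∀ y ∈ K, (g₀.lift x y).1 ∈ T.changeDom (T.bundleProj (g₀.toFun x)) z) ∧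
      (s : ℕ∞) ≤ r ∧ 0 < ε ∧ N = T.mapNhd g₀ x z K s ε}

/-- A `C^r` orbisection `σ` of the pullback orbibundle `f^*(TP)`: a continuous map `σ` with
`p ∘ σ = Id` which has over each chart `W_x` an equivariant `C^r` lift `σ̃_x` with
`pr₁ ∘ σ̃_x = Id`, that is, `σ̃_x(ỹ) = (ỹ, s̃_x(ỹ))`. The function `s̃_x = repr x` matters only on
`W_x`, so it is put to be `0` elsewhere, in order that equal orbisections be equal. -/
@[ext]
structure Orbisection (r : ℕ∞) where
  toFun : X → T.Total
  continuous_toFun : Continuous toFun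
  bundleProj_toFun : ∀ x, T.bundleProj (toFun x) = x
  repr : X → Eu n → Eu m
  repr_eq_zero : ∀ x, ∀ y, y ∉ f.dom x → repr x y = 0
  contDiffOn_repr : ∀ x, ContDiffOn ℝ (r : WithTop ℕ∞) (repr x) (f.dom x)
  toTotal_repr : ∀ x, ∀ y, ∀ hy : y ∈ f.dom x,
    T.toTotal x (y, repr x y) hy = toFun ((O.chart x).proj y)
  equivariant : ∀ x, ∃ Θ' : (O.chart x).Γ →* (O.chart x).Γ, ∀ γ, ∀ y ∈ f.dom x,
    ((O.chart x).act γ y, repr x ((O.chart x).act γ y)) = T.bundleAct x (Θ' γ) (y, repr x y)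

/-- An orbisection as an orbifold map, with the lifts `σ̃_x(ỹ) = (ỹ, s̃_x(ỹ))`. -/
def Orbisection.toMapRep {r : ℕ∞} (σ : T.Orbisection r) : T.MapRep r where
  toFun := σ.toFun
  continuous_toFun := σ.continuous_toFun
  dom := f.dom
  isSubchart_dom := f.isSubchart_dom
  lift x y := (y, σ.repr x y)
  mapsTo_lift x y hy := by rw [σ.bundleProj_toFun x]; exact hy
  contDiffOn_lift x := contDiffOn_id.prodMk (σ.contDiffOn_repr x)
  toTotal_lift x y hy := by
    have key : ∀ z, z = x → ∀ h : y ∈ f.dom z,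
        T.toTotal z (y, σ.repr x y) h = σ.toFun ((O.chart x).proj y) := by
      rintro z rfl h
      exact σ.toTotal_repr z y h
    exact key _ (σ.bundleProj_toFun x) _
  equivariant x := by
    have key : ∀ z, z = x → ∃ Θ' : (O.chart x).Γ →* (O.chart z).Γ, ∀ γ, ∀ y ∈ f.dom x,
        ((O.chart x).act γ y, σ.repr x ((O.chart x).act γ y)) =
          T.bundleAct z (Θ' γ) (y, σ.repr x y) := by
      rintro z rfl
      exact σ.equivariant z
    exact key _ (σ.bundleProj_toFun x)

/-- The inclusion of the set of `C^r` orbisections into `C^r_Orb(O, f^*(TP))`. -/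
def Orbisection.toOrbMap {r : ℕ∞} (σ : T.Orbisection r) : T.OrbMap r :=
  Quotient.mk (T.mapSetoid r) (Orbisection.toMapRep T σ)

/-- The `C^r` topology on the set of orbisections, induced by the inclusion. -/
instance (r : ℕ∞) : TopologicalSpace (T.Orbisection r) :=
  TopologicalSpace.induced (Orbisection.toOrbMap T) inferInstance

end Transitions

end CompleteOrbifoldMap

end CompleteMaps

/-- The topological vector space `C^r(K, F)`, for `K ⊆ ℝⁿ` a compact set which is the closure of its
interior: the `C^r` functions `g` on the interior of `K` whose derivatives of order `j ≤ r` extend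
continuously to `K`, with the topology of uniform convergence of all derivatives of order `≤ r`. An
element is given as the family of the extended derivatives. -/
def CrSpace {n : ℕ} (r : ℕ∞) (K : Set (Eu n)) (F : Type*) [NormedAddCommGroup F]
    [NormedSpace ℝ F] :
    Submodule ℝ (∀ j : {j : ℕ // (j : ℕ∞) ≤ r}, C(K, Eu n [×(j : ℕ)]→L[ℝ] F)) where
  carrier := {J | ∃ g : Eu n → F, ContDiffOn ℝ (r : WithTop ℕ∞) g (interior K) ∧
    ∀ j, ∀ y : K, (y : Eu n) ∈ interior K → J j y = iteratedFDeriv ℝ (j : ℕ) g y}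
  zero_mem' := by
    refine ⟨0, contDiffOn_const, fun j y _ => ?_⟩
    simp
  add_mem' := by
    rintro J J' ⟨g, hg, hJ⟩ ⟨g', hg', hJ'⟩
    refine ⟨g + g', hg.add hg', fun j y hy => ?_⟩
    have hj : ((j : ℕ) : WithTop ℕ∞) ≤ (r : WithTop ℕ∞) := by exact_mod_cast j.2
    have h1 := (hg.contDiffAt (isOpen_interior.mem_nhds hy)).of_le hj
    have h2 := (hg'.contDiffAt (isOpen_interior.mem_nhds hy)).of_le hj
    rw [iteratedFDeriv_add_apply h1 h2, ← hJ j y hy, ← hJ' j y hy]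
    rfl
  smul_mem' := by
    rintro c J ⟨g, hg, hJ⟩
    refine ⟨c • g, hg.const_smul c, fun j y hy => ?_⟩
    have hj : ((j : ℕ) : WithTop ℕ∞) ≤ (r : WithTop ℕ∞) := by exact_mod_cast j.2
    have h1 := (hg.contDiffAt (isOpen_interior.mem_nhds hy)).of_le hj
    rw [iteratedFDeriv_const_smul_apply h1, ← hJ j y hy]
    rfl

/-- The topological vector space `V` is a Banach space: its topology is that of a complete norm. -/
def IsBanachable.{u} (V : Type u) [AddCommGroup V] [Module ℝ V] [TopologicalSpace V] : Prop :=
  ∃ (B : Type u) (_ : NormedAddCommGroup B) (_ : NormedSpace ℝ B) (_ : CompleteSpace B),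
    Nonempty (V ≃L[ℝ] B)

/-- The topological vector space `V` is a Fréchet space: it is locally convex, metrizable and
complete. -/
def IsFrechet (V : Type*) [AddCommGroup V] [Module ℝ V] [TopologicalSpace V]
    [IsTopologicalAddGroup V] : Prop :=
  LocallyConvexSpace ℝ V ∧ TopologicalSpace.MetrizableSpace V ∧
    @CompleteSpace V (IsTopologicalAddGroup.rightUniformSpace V)

/-! An orbisection is determined by its local representatives `repr x`. To see this, one attaches to
a point of the disjoint union of charts the invariant `fibreVectors`; it is constant under the
generating identifications, and shows that two points of one chart are identified only by the local
group (`exists_bundleAct_eq_of_toTotal_eq`). Hence the representatives are determined by the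
underlying map, are equivariant, and are related at the centres of charts by the differentials dη.
Conversely, families with these properties glue. The conditions are linear (`sectionSpace`), which
gives the vector space structure.

Coherence of the transition data extends the relation at the centres to a neighbourhood
(`eventually_repr_ψ`). So near two chart points with the same image, the representatives of all
orbisections differ by one C^r change of coordinates and one C^r matrix function
(`transfer_of_proj_eq`); the derivative lost in dη is the reason for the class C^(r+1) of the data.
By bounds for derivatives of compositions and products, closeness on a finite cover by compact sets
K_i controls closeness on every compact subset of every chart.

It follows that `jets`, which sends an orbisection to its derivatives on the K_i, induces the C^r
topology (`isInducing_jets`). It is injective, and its range is closed (`isClosed_range_jets`):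
uniform limits of all derivatives are C^r, and linear conditions pass to limits. The target is a
countable product of separable Banach spaces, finite if r < ∞.

One point concerns the ambient space of orbifold maps, where equality is equality of underlying maps
and of germs of lifts at the centres. A lift with the germ of an orbisection agrees with it on its
whole domain (`eq_repr_of_lift`), by rigidity of finite effective C^1 actions
(`eq_self_of_proj_eq`); this uses r ≥ 1. -/

theorem ENat.coe_withTop_ne_zero {k : ℕ∞} (hk : 1 ≤ k) : (k : WithTop ℕ∞) ≠ 0 := by
  intro h
  norm_cast at h
  subst h
  simp at hk

/-! ### Rigidity of finite effective actions on a chart -/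

namespace OrbifoldChart

variable {n : ℕ} {k : ℕ∞} {X : Type*} [TopologicalSpace X] {x : X} (c : OrbifoldChart n k X x)

theorem act_inv_act (γ : c.Γ) {y : Eu n} (hy : y ∈ c.dom) : c.act γ⁻¹ (c.act γ y) = y := by
  rw [← c.act_mul _ _ _ hy, inv_mul_cancel, c.act_one _ hy]

theorem act_act_inv (γ : c.Γ) {y : Eu n} (hy : y ∈ c.dom) : c.act γ (c.act γ⁻¹ y) = y := by
  rw [← c.act_mul _ _ _ hy, mul_inv_cancel, c.act_one _ hy]

theorem contDiffAt_act (γ : c.Γ) {y : Eu n} (hy : y ∈ c.dom) :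
    ContDiffAt ℝ (k : WithTop ℕ∞) (c.act γ) y :=
  (c.contDiffOn_act γ).contDiffAt (c.isOpen_dom.mem_nhds hy)

theorem continuousAt_act (γ : c.Γ) {y : Eu n} (hy : y ∈ c.dom) : ContinuousAt (c.act γ) y :=
  (c.contDiffAt_act γ hy).continuousAt

theorem differentiableAt_act (hk : 1 ≤ k) (γ : c.Γ) {y : Eu n} (hy : y ∈ c.dom) :
    DifferentiableAt ℝ (c.act γ) y :=
  (c.contDiffAt_act γ hy).differentiableAt (ENat.coe_withTop_ne_zero hk)

theorem fderiv_act_mul (hk : 1 ≤ k) (γ δ : c.Γ) {y : Eu n} (hy : y ∈ c.dom) :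
    fderiv ℝ (c.act (γ * δ)) y = (fderiv ℝ (c.act γ) (c.act δ y)).comp (fderiv ℝ (c.act δ) y) := by
  have h : c.act (γ * δ) =ᶠ[𝓝 y] c.act γ ∘ c.act δ := by
    filter_upwards [c.isOpen_dom.mem_nhds hy] with u hu using c.act_mul _ _ _ hu
  rw [h.fderiv_eq, fderiv_comp _ (c.differentiableAt_act hk γ (c.mapsTo_act δ hy))
    (c.differentiableAt_act hk δ hy)]

theorem fderiv_act_one {y : Eu n} (hy : y ∈ c.dom) :
    fderiv ℝ (c.act 1) y = ContinuousLinearMap.id ℝ (Eu n) := by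
  have h : c.act 1 =ᶠ[𝓝 y] id := by
    filter_upwards [c.isOpen_dom.mem_nhds hy] with u hu using c.act_one _ hu
  rw [h.fderiv_eq, fderiv_id]

/-- A finite-order `C^1` map with a fixed point where its derivative is the identity is the identity
near this point: the average of its powers is a local coordinate, and invariant. -/
theorem eventually_act_eq_self (hk : 1 ≤ k) (γ : c.Γ) {y : Eu n} (hy : y ∈ c.dom)
    (hfix : c.act γ y = y) (hd : fderiv ℝ (c.act γ) y = ContinuousLinearMap.id ℝ (Eu n)) :
    ∀ᶠ u in 𝓝 y, c.act γ u = u := by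
  classical
  set N := orderOf γ with hN
  have hNpos : 0 < N := orderOf_pos γ
  have hpow : ∀ i : ℕ, c.act (γ ^ i) y = y ∧
      fderiv ℝ (c.act (γ ^ i)) y = ContinuousLinearMap.id ℝ (Eu n) := by
    intro i
    induction i with
    | zero => rw [pow_zero]; exact ⟨c.act_one y hy, c.fderiv_act_one hy⟩
    | succ i ih =>
      rw [pow_succ]
      refine ⟨by rw [c.act_mul _ _ _ hy, hfix, ih.1], ?_⟩
      rw [c.fderiv_act_mul hk _ _ hy, hfix, ih.2, hd]
      rfl
  let h : Eu n → Eu n := fun u => ∑ i ∈ Finset.range N, c.act (γ ^ i) u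
  have hk' : (1 : WithTop ℕ∞) ≤ (k : WithTop ℕ∞) := by exact_mod_cast hk
  have hstrict : HasStrictFDerivAt h ((N : ℝ) • ContinuousLinearMap.id ℝ (Eu n)) y := by
    have : HasStrictFDerivAt h (∑ i ∈ Finset.range N, fderiv ℝ (c.act (γ ^ i)) y) y := by
      apply HasStrictFDerivAt.fun_sum
      intro i _
      exact (c.contDiffAt_act (γ ^ i) hy).hasStrictFDerivAt (by
        intro h0; rw [h0] at hk'; simp at hk')
    rw [Finset.sum_congr rfl (fun i _ => (hpow i).2)] at this
    rwa [Finset.sum_const, Finset.card_range, ← Nat.cast_smul_eq_nsmul ℝ] at this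
  have hN0 : (N : ℝ) ≠ 0 := by exact_mod_cast hNpos.ne'
  let e : Eu n ≃L[ℝ] Eu n := ContinuousLinearEquiv.smulLeft (Units.mk0 (N : ℝ) hN0)
  have hstrict' : HasStrictFDerivAt h (e : Eu n →L[ℝ] Eu n) y := by
    convert hstrict using 1
    ext v i
    simp [e, Units.smul_def]
  have hinv : ∀ u ∈ c.dom, h (c.act γ u) = h u := by
    intro u hu
    have h1 : h (c.act γ u) = ∑ i ∈ Finset.range N, c.act (γ ^ (i + 1)) u := by
      refine Finset.sum_congr rfl fun i _ => ?_
      rw [pow_succ, c.act_mul _ _ _ hu]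
    rw [h1]
    -- The sum over the exponents `0, …, N` is split at its last and at its first term; these two
    -- terms agree because `γ ^ N = 1`.
    have h2 := Finset.sum_range_succ (fun i => c.act (γ ^ i) u) N
    have h3 := Finset.sum_range_succ' (fun i => c.act (γ ^ i) u) N
    rw [h2] at h3
    simp only [hN, pow_orderOf_eq_one, pow_zero] at h3
    exact (add_right_cancel h3).symm
  let L := HasStrictFDerivAt.toOpenPartialHomeomorph h hstrict'
  have hmem : L.source ∈ 𝓝 y := L.open_source.mem_nhds 
    (HasStrictFDerivAt.mem_toOpenPartialHomeomorph_source hstrict')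
  have hmem2 : ∀ᶠ u in 𝓝 y, c.act γ u ∈ L.source := by
    apply (c.continuousAt_act γ hy)
    rw [hfix]; exact hmem
  filter_upwards [hmem, hmem2, c.isOpen_dom.mem_nhds hy] with u hu hu' hud
  apply L.injOn hu' hu
  exact hinv u hud

/-- The interior of the fixed set of `γ` is relatively closed in the connected domain: at a limit
point, continuity of `γ` and of its derivative gives a fixed point with identity derivative, and
`eventually_act_eq_self` applies. Effectiveness concludes. -/
theorem eq_one_of_eventually (hk : 1 ≤ k) (γ : c.Γ) {y : Eu n} (hy : y ∈ c.dom)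
    (h : ∀ᶠ u in 𝓝 y, c.act γ u = u) : γ = 1 := by
  let V : Set (Eu n) := interior {u | c.act γ u = u}
  have hsub : c.dom ⊆ V := by
    apply c.isConnected_dom.isPreconnected.subset_of_closure_inter_subset isOpen_interior
    · exact ⟨y, hy, mem_interior_iff_mem_nhds.2 h⟩
    · rintro z ⟨hz, hzd⟩
      have : (𝓝[V] z).NeBot := mem_closure_iff_nhdsWithin_neBot.1 hz
      have hfix : c.act γ z = z := by
        have h1 : Tendsto (c.act γ) (𝓝[V] z) (𝓝 (c.act γ z)) :=
          (c.continuousAt_act γ hzd).mono_left nhdsWithin_le_nhds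
        have h2 : Tendsto (c.act γ) (𝓝[V] z) (𝓝 z) := by
          refine (tendsto_id.mono_left nhdsWithin_le_nhds).congr' ?_
          filter_upwards [self_mem_nhdsWithin] with u hu
          exact (mem_ofPred.1 (interior_subset hu)).symm
        exact tendsto_nhds_unique h1 h2
      have hd : fderiv ℝ (c.act γ) z = ContinuousLinearMap.id ℝ (Eu n) := by
        have hc : ContinuousAt (fderiv ℝ (c.act γ)) z :=
          ((c.contDiffOn_act γ).continuousOn_fderiv_of_isOpen c.isOpen_dom
            (by exact_mod_cast hk)).continuousAt (c.isOpen_dom.mem_nhds hzd)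
        have h1 : Tendsto (fderiv ℝ (c.act γ)) (𝓝[V] z) (𝓝 (fderiv ℝ (c.act γ) z)) :=
          hc.mono_left nhdsWithin_le_nhds
        have h2 : Tendsto (fderiv ℝ (c.act γ)) (𝓝[V] z)
            (𝓝 (ContinuousLinearMap.id ℝ (Eu n))) := by
          refine tendsto_const_nhds.congr' ?_
          filter_upwards [self_mem_nhdsWithin] with u hu
          have : c.act γ =ᶠ[𝓝 u] id := mem_interior_iff_mem_nhds.1 hu
          rw [this.fderiv_eq, fderiv_id]
        exact tendsto_nhds_unique h1 h2
      exact mem_interior_iff_mem_nhds.2 (c.eventually_act_eq_self hk γ hzd hfix hd)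
  exact c.effective γ (hsub.trans interior_subset)

/-- Points with trivial stabilizer are dense in the chart. -/
theorem frequently_free (hk : 1 ≤ k) {y : Eu n} (hy : y ∈ c.dom) :
    ∃ᶠ u in 𝓝 y, u ∈ c.dom ∧ ∀ γ, c.act γ u = u → γ = 1 := by
  classical
  have : Fintype c.Γ := Fintype.ofFinite _
  let A : c.Γ → Set (Eu n) := fun γ => {u | u ∈ c.dom ∧ c.act γ u = u}
  have hopen : ∀ γ, IsOpen (c.dom \ A γ) := by
    intro γ
    rw [isOpen_iff_mem_nhds]
    rintro u ⟨hu, hu'⟩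
    have hne : c.act γ u ≠ u := fun h => hu' ⟨hu, h⟩
    filter_upwards [c.isOpen_dom.mem_nhds hu,
      ((c.continuousAt_act γ hu).ne_iff_eventually_ne continuousAt_id).1 hne] with v hv hv'
    exact ⟨hv, fun h => hv' h.2⟩
  -- The fixed sets of nontrivial elements are relatively closed and have empty interior, so they
  -- can be avoided one at a time on shrinking open sets.
  have key : ∀ S : Finset c.Γ, (∀ γ ∈ S, γ ≠ 1) → ∀ U : Set (Eu n), IsOpen U → U ⊆ c.dom →
      U.Nonempty → ∃ V ⊆ U, IsOpen V ∧ V.Nonempty ∧ ∀ γ ∈ S, ∀ u ∈ V, c.act γ u ≠ u := by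
    intro S
    induction S using Finset.induction_on with
    | empty => intro _ U hU _ hne; exact ⟨U, subset_rfl, hU, hne, by simp⟩
    | insert γ S _ ih =>
      intro hS U hU hUd hne
      obtain ⟨V, hVU, hV, ⟨v, hv⟩, hVS⟩ :=
        ih (fun δ hδ => hS δ (Finset.mem_insert_of_mem hδ)) U hU hUd hne
      refine ⟨V ∩ (c.dom \ A γ), inter_subset_left.trans hVU, hV.inter (hopen γ), ?_, ?_⟩
      · by_contra hcon
        apply hS γ (Finset.mem_insert_self _ _)
        apply c.eq_one_of_eventually hk γ (hUd (hVU hv))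
        filter_upwards [hV.mem_nhds hv] with u hu
        by_contra hu'
        exact hcon ⟨u, hu, hUd (hVU hu), fun h => hu' h.2⟩
      · intro δ hδ u hu
        rcases Finset.mem_insert.1 hδ with rfl | hδ
        · exact fun h => hu.2.2 ⟨hu.2.1, h⟩
        · exact hVS δ hδ u hu.1
  rw [frequently_iff]
  intro U hU
  obtain ⟨V, hVU, -, ⟨v, hv⟩, hV⟩ := key (Finset.univ.erase 1) (by simp) (interior U ∩ c.dom)
    (isOpen_interior.inter c.isOpen_dom) inter_subset_right
    ⟨y, mem_interior_iff_mem_nhds.2 hU, hy⟩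
  refine ⟨v, interior_subset (hVU hv).1, (hVU hv).2, fun γ hγ => ?_⟩
  by_contra hne
  exact hV γ (by simp [hne]) v hv hγ

/-- A `C^1` map into the chart over the identity which is the identity near one point of its connected
domain is the identity. -/
theorem eq_self_of_proj_eq (hk : 1 ≤ k) {D : Set (Eu n)} (hD : IsOpen D) (hDc : IsPreconnected D)
    (hDd : D ⊆ c.dom) {h : Eu n → Eu n} (hh : ContDiffOn ℝ 1 h D) (hmaps : MapsTo h D c.dom)
    (hproj : ∀ y ∈ D, c.proj (h y) = c.proj y) {y₀ : Eu n} (hy₀ : y₀ ∈ D)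
    (hid : ∀ᶠ u in 𝓝 y₀, h u = u) : ∀ y ∈ D, h y = y := by
  let V : Set (Eu n) := interior {u | h u = u}
  suffices hsub : D ⊆ V from hsub.trans interior_subset
  apply hDc.subset_of_closure_inter_subset isOpen_interior
  · exact ⟨y₀, hy₀, mem_interior_iff_mem_nhds.2 hid⟩
  rintro z ⟨hz, hzD⟩
  have : (𝓝[V] z).NeBot := mem_closure_iff_nhdsWithin_neBot.1 hz
  have hcont : ∀ u ∈ D, ContinuousAt h u := fun u hu =>
    hh.continuousOn.continuousAt (hD.mem_nhds hu)
  have hcd : ContinuousAt (fderiv ℝ h) z :=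
    (hh.continuousOn_fderiv_of_isOpen hD le_rfl).continuousAt (hD.mem_nhds hzD)
  have hfix : h z = z := by
    have h1 : Tendsto h (𝓝[V] z) (𝓝 (h z)) := (hcont z hzD).mono_left nhdsWithin_le_nhds
    have h2 : Tendsto h (𝓝[V] z) (𝓝 z) := by
      refine (tendsto_id.mono_left nhdsWithin_le_nhds).congr' ?_
      filter_upwards [self_mem_nhdsWithin] with u hu
      exact (mem_ofPred.1 (interior_subset hu)).symm
    exact tendsto_nhds_unique h1 h2
  have hd : fderiv ℝ h z = ContinuousLinearMap.id ℝ (Eu n) := by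
    have h1 : Tendsto (fderiv ℝ h) (𝓝[V] z) (𝓝 (fderiv ℝ h z)) :=
      hcd.mono_left nhdsWithin_le_nhds
    have h2 : Tendsto (fderiv ℝ h) (𝓝[V] z) (𝓝 (ContinuousLinearMap.id ℝ (Eu n))) := by
      refine tendsto_const_nhds.congr' ?_
      filter_upwards [self_mem_nhdsWithin] with u hu
      have : h =ᶠ[𝓝 u] id := mem_interior_iff_mem_nhds.1 hu
      rw [this.fderiv_eq, fderiv_id]
    exact tendsto_nhds_unique h1 h2
  have hzd := hDd hzD
  -- No nontrivial `γ` has the germ of `h` at a point near `z`: either `γ` moves `z` while `h` fixes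
  -- it, or its derivative at `z` is not the identity while that of `h` is. Both inequalities are
  -- open conditions.
  have hne : ∀ᶠ u in 𝓝 z, ∀ γ : c.Γ, γ ≠ 1 → ¬ (h =ᶠ[𝓝 u] c.act γ) := by
    rw [eventually_all]
    intro γ
    by_cases hγ : γ = 1
    · simp [hγ]
    by_cases hγz : c.act γ z = z
    · have hcγ : ContinuousAt (fderiv ℝ (c.act γ)) z :=
        ((c.contDiffOn_act γ).continuousOn_fderiv_of_isOpen c.isOpen_dom
            (by exact_mod_cast hk)).continuousAt (c.isOpen_dom.mem_nhds hzd)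
      have hne : fderiv ℝ h z ≠ fderiv ℝ (c.act γ) z := by
        intro he
        exact hγ (c.eq_one_of_eventually hk γ hzd
          (c.eventually_act_eq_self hk γ hzd hγz (he ▸ hd)))
      filter_upwards [(hcd.ne_iff_eventually_ne hcγ).1 hne] with u hu _ he
      exact hu he.fderiv_eq
    · have hne : h z ≠ c.act γ z := fun he => hγz (he ▸ hfix)
      filter_upwards [((hcont z hzD).ne_iff_eventually_ne (c.continuousAt_act γ hzd)).1 hne] with u hu _ he
      exact hu he.eq_of_nhds
  -- At a point with trivial stabilizer the translates are distinct, so the element `γ` with `h = γ`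
  -- is locally constant by continuity, and `hne` leaves only `γ = 1`.
  have hfree : ∀ᶠ u in 𝓝 z, (∀ γ, c.act γ u = u → γ = 1) → h u = u := by
    filter_upwards [hne, hD.mem_nhds hzD] with u hu huD hfr
    obtain ⟨γ, hγ⟩ := (c.proj_eq_iff u (hDd huD) (h u) (hmaps huD)).1 (hproj u huD).symm
    have hloc : h =ᶠ[𝓝 u] c.act γ := by
      have : ∀ᶠ v in 𝓝 u, ∀ δ : c.Γ, δ ≠ γ → h v ≠ c.act δ v := by
        rw [eventually_all]
        intro δ
        by_cases hδ : δ = γ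
        · simp [hδ]
        have hne : h u ≠ c.act δ u := by
          rw [← hγ]
          intro he
          apply hδ
          have : c.act (δ⁻¹ * γ) u = u := by
            rw [c.act_mul _ _ _ (hDd huD), he, c.act_inv_act _ (hDd huD)]
          have := hfr _ this
          exact (inv_mul_eq_one.1 this)
        filter_upwards [((hcont u huD).ne_iff_eventually_ne
          (c.continuousAt_act δ (hDd huD))).1 hne]
          with v hv _ using hv
      filter_upwards [this, hD.mem_nhds huD] with v hv hvD
      obtain ⟨δ, hδ⟩ := (c.proj_eq_iff v (hDd hvD) (h v) (hmaps hvD)).1 (hproj v hvD).symm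
      by_cases hδγ : δ = γ
      · rw [← hδ, hδγ]
      · exact absurd hδ.symm (hv δ hδγ)
    by_cases hγ1 : γ = 1
    · rw [← hγ, hγ1, c.act_one _ (hDd huD)]
    · exact absurd hloc (hu γ hγ1)
  apply mem_interior_iff_mem_nhds.2
  have hfree' := hfree.eventually_nhds
  filter_upwards [hfree', hD.mem_nhds hzD] with u hu huD
  -- If `h` moved `u`, it would move all points nearby, among them a free point.
  by_contra hcon
  have hcon' : ∀ᶠ v in 𝓝 u, h v ≠ v := ((hcont u huD).ne_iff_eventually_ne continuousAt_id).1 hcon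
  obtain ⟨v, hv⟩ := ((c.frequently_free hk (hDd huD)).and_eventually (hu.and hcon')).exists
  exact hv.2.2 (hv.2.1 hv.1.2)

end OrbifoldChart

/-! ### Embeddings of orbifold charts -/

namespace Orbifold

variable {n : ℕ} {k : ℕ∞} {X : Type*} [TopologicalSpace X] (O : Orbifold n k X) {z x : X}

/-- The stabilizer of `ψ̃_zx(z̃)` is the image of `Γ_z`. -/
theorem exists_θ_eq (hk : 1 ≤ k) (hz : z ∈ (O.chart x).proj '' (O.chart x).dom)
    {δ : (O.chart x).Γ}
    (hδ : (O.chart x).act δ (O.ψ z x (O.chart z).center) = O.ψ z x (O.chart z).center) :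
    ∃ γ, O.θ z x γ = δ := by
  set p := O.ψ z x (O.chart z).center with hp
  have hsrc := O.center_mem_source z x hz
  have hpt : p ∈ (O.ψ z x).target := (O.ψ z x).map_source hsrc
  have hpd := O.target_subset z x hz hpt
  have h1 : ∀ᶠ u in 𝓝 p, u ∈ (O.ψ z x).target := (O.ψ z x).open_target.mem_nhds hpt
  have h2 : ∀ᶠ u in 𝓝 p, (O.chart x).act δ u ∈ (O.ψ z x).target := by
    apply (O.chart x).continuousAt_act δ hpd
    rw [hδ]
    exact (O.ψ z x).open_target.mem_nhds hpt
  -- A free point `u` such that `u` and `δ · u` both lie in the image of the embedding. Their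
  -- preimages have the same projection, hence differ by some `γ` in the group at `z`, and freeness
  -- of `u` forces `θ γ = δ`.
  obtain ⟨u, ⟨hud, hfree⟩, hu1, hu2⟩ :=
    (((O.chart x).frequently_free hk hpd).and_eventually (h1.and h2)).exists
  have hs1 := (O.ψ z x).map_target hu1
  have hs2 := (O.ψ z x).map_target hu2
  have hpr : (O.chart z).proj ((O.ψ z x).symm u) =
      (O.chart z).proj ((O.ψ z x).symm ((O.chart x).act δ u)) := by
    rw [← O.proj_ψ z x hz _ hs1, ← O.proj_ψ z x hz _ hs2, (O.ψ z x).right_inv hu1,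
      (O.ψ z x).right_inv hu2]
    exact ((O.chart x).proj_eq_iff _ hud _ ((O.chart x).mapsTo_act δ hud)).2 ⟨δ, rfl⟩
  obtain ⟨γ, hγ⟩ := ((O.chart z).proj_eq_iff _ (O.source_subset z x hz hs1) _
    (O.source_subset z x hz hs2)).1 hpr
  refine ⟨γ, ?_⟩
  have h3 := O.ψ_act z x hz γ _ hs1
  rw [hγ, (O.ψ z x).right_inv hu1, (O.ψ z x).right_inv hu2] at h3
  have h4 : (O.chart x).act ((O.θ z x γ)⁻¹ * δ) u = u := by
    rw [(O.chart x).act_mul _ _ _ hud, h3, (O.chart x).act_inv_act _ hud]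
  exact inv_mul_eq_one.1 (hfree _ h4)

theorem mem_proj_image_self (x : X) : x ∈ (O.chart x).proj '' (O.chart x).dom :=
  ⟨_, (O.chart x).center_mem, (O.chart x).proj_center⟩

theorem proj_ψ_center (hz : z ∈ (O.chart x).proj '' (O.chart x).dom) :
    (O.chart x).proj (O.ψ z x (O.chart z).center) = z := by
  rw [O.proj_ψ z x hz _ (O.center_mem_source z x hz), (O.chart z).proj_center]

/-- The centre is fixed by the whole group, so it is the only point of its chart over `x`. -/
theorem ψ_self_center (x : X) : O.ψ x x (O.chart x).center = (O.chart x).center := by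
  have hx := O.mem_proj_image_self x
  have hd := O.target_subset x x hx ((O.ψ x x).map_source (O.center_mem_source x x hx))
  obtain ⟨γ, hγ⟩ := ((O.chart x).proj_eq_iff _ (O.chart x).center_mem _ hd).1
    (by rw [O.proj_ψ_center hx, (O.chart x).proj_center])
  rw [← hγ, (O.chart x).act_center]

theorem contDiffAt_ψ (hz : z ∈ (O.chart x).proj '' (O.chart x).dom) {y : Eu n}
    (hy : y ∈ (O.ψ z x).source) : ContDiffAt ℝ (k : WithTop ℕ∞) (O.ψ z x) y :=
  (O.contDiffOn_ψ z x hz).contDiffAt ((O.ψ z x).open_source.mem_nhds hy)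

theorem contDiffAt_ψ_symm (hz : z ∈ (O.chart x).proj '' (O.chart x).dom) {y : Eu n}
    (hy : y ∈ (O.ψ z x).target) : ContDiffAt ℝ (k : WithTop ℕ∞) (O.ψ z x).symm y :=
  (O.contDiffOn_ψ_symm z x hz).contDiffAt ((O.ψ z x).open_target.mem_nhds hy)

end Orbifold

/-! ### The pullback orbibundle and the identifications in it -/

namespace CompleteOrbifoldMap

variable {n m : ℕ} {k : ℕ∞} {X Y : Type*} [TopologicalSpace X] [TopologicalSpace Y]
  {O : Orbifold n k X} {P : Orbifold m k Y} (f : CompleteOrbifoldMap O P) {w z x : X}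

theorem dom_subset (x : X) : f.dom x ⊆ (O.chart x).dom := (f.isSubchart_dom x).subset_dom

theorem center_mem_dom (x : X) : (O.chart x).center ∈ f.dom x := (f.isSubchart_dom x).center_mem

theorem dom_mem_nhds {y : Eu n} (hy : y ∈ f.dom x) : f.dom x ∈ 𝓝 y :=
  (f.isSubchart_dom x).isOpen.mem_nhds hy

theorem act_mem_dom (γ : (O.chart x).Γ) {y : Eu n} (hy : y ∈ f.dom x) :
    (O.chart x).act γ y ∈ f.dom x := (f.isSubchart_dom x).mapsTo_act γ hy

theorem mem_base_self (x : X) : x ∈ f.base x :=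
  ⟨_, f.center_mem_dom x, (O.chart x).proj_center⟩

theorem proj_mem_base {y : Eu n} (hy : y ∈ f.dom x) : (O.chart x).proj y ∈ f.base x :=
  mem_image_of_mem _ hy

theorem isOpen_base (x : X) : IsOpen (f.base x) :=
  (O.chart x).isOpen_image_proj _ (f.dom_subset x) (f.isSubchart_dom x).isOpen

theorem base_subset (hz : z ∈ f.base x) : z ∈ (O.chart x).proj '' (O.chart x).dom :=
  image_mono (f.dom_subset x) hz

theorem toFun_mem_image (hz : z ∈ f.base x) :
    f.toFun z ∈ (P.chart (f.toFun x)).proj '' (P.chart (f.toFun x)).dom := by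
  obtain ⟨y, hy, rfl⟩ := hz
  exact ⟨f.lift x y, f.mapsTo_lift x hy, f.proj_lift x y hy⟩

/-- An invariant subset of a chart is saturated with respect to the projection. -/
theorem mem_dom_of_proj_mem_base {y : Eu n} (hy : y ∈ (O.chart x).dom)
    (h : (O.chart x).proj y ∈ f.base x) : y ∈ f.dom x := by
  obtain ⟨y', hy', he⟩ := h
  obtain ⟨γ, rfl⟩ := ((O.chart x).proj_eq_iff _ (f.dom_subset x hy') _ hy).1 he
  exact f.act_mem_dom γ hy'

theorem ψ_mem_dom (hz : z ∈ f.base x) {y : Eu n} (hy : y ∈ (O.ψ z x).source)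
    (h : (O.chart z).proj y ∈ f.base x) : O.ψ z x y ∈ f.dom x := by
  have hz' := f.base_subset hz
  refine f.mem_dom_of_proj_mem_base (O.target_subset z x hz' ((O.ψ z x).map_source hy)) ?_
  rwa [O.proj_ψ z x hz' _ hy]

theorem ψ_center_mem_dom (hz : z ∈ f.base x) : O.ψ z x (O.chart z).center ∈ f.dom x := by
  apply f.ψ_mem_dom hz (O.center_mem_source z x (f.base_subset hz))
  rwa [(O.chart z).proj_center]

theorem exists_act_eq {y y' : Eu n} (hy : y ∈ f.dom x) (hy' : y' ∈ f.dom x)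
    (h : (O.chart x).proj y = (O.chart x).proj y') : ∃ γ, (O.chart x).act γ y = y' :=
  ((O.chart x).proj_eq_iff _ (f.dom_subset x hy) _ (f.dom_subset x hy')).1 h

theorem exists_act_ψ_center_eq {y : Eu n} (hy : y ∈ f.dom x) (h : (O.chart x).proj y = w) :
    ∃ γ, (O.chart x).act γ (O.ψ w x (O.chart w).center) = y := by
  have hw : w ∈ f.base x := h ▸ f.proj_mem_base hy
  exact f.exists_act_eq (f.ψ_center_mem_dom hw) hy
    (by rw [O.proj_ψ_center (f.base_subset hw), h])

theorem lift_center (x : X) : f.lift x (O.chart x).center = (P.chart (f.toFun x)).center := by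
  have hc := f.center_mem_dom x
  obtain ⟨γ, hγ⟩ := ((P.chart (f.toFun x)).proj_eq_iff _ (P.chart (f.toFun x)).center_mem _
    (f.mapsTo_lift x hc)).1
    (by rw [f.proj_lift x _ hc, (P.chart (f.toFun x)).proj_center, (O.chart x).proj_center])
  rw [← hγ, (P.chart (f.toFun x)).act_center]

theorem contDiffAt_lift {y : Eu n} (hy : y ∈ f.dom x) :
    ContDiffAt ℝ (k : WithTop ℕ∞) (f.lift x) y :=
  (f.contDiffOn_lift x).contDiffAt (f.dom_mem_nhds hy)

theorem continuousAt_lift {y : Eu n} (hy : y ∈ f.dom x) : ContinuousAt (f.lift x) y :=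
  (f.contDiffAt_lift hy).continuousAt

theorem continuousAt_proj {y : Eu n} (hy : y ∈ f.dom x) : ContinuousAt (O.chart x).proj y :=
  (O.chart x).continuousOn_proj.continuousAt ((O.chart x).isOpen_dom.mem_nhds (f.dom_subset x hy))

theorem lift_center_mem_source (hz : z ∈ f.base x) :
    f.lift z (O.chart z).center ∈ (P.ψ (f.toFun z) (f.toFun x)).source := by
  rw [f.lift_center]
  exact P.center_mem_source _ _ (f.toFun_mem_image hz)

namespace Transitions

variable {f} (T : f.Transitions)

theorem contDiffAt_η (hz : z ∈ f.base x) {u : Eu m}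
    (hu : u ∈ (P.ψ (f.toFun z) (f.toFun x)).source) :
    ContDiffAt ℝ (k : WithTop ℕ∞) (T.η z x) u := by
  have hz' := f.toFun_mem_image hz
  exact ((P.chart (f.toFun x)).contDiffAt_act (T.ε z x) (P.target_subset _ _ hz'
    ((P.ψ (f.toFun z) (f.toFun x)).map_source hu))).comp u (P.contDiffAt_ψ hz' hu)

theorem η_mem_dom (hz : z ∈ f.base x) {u : Eu m}
    (hu : u ∈ (P.ψ (f.toFun z) (f.toFun x)).source) :
    T.η z x u ∈ (P.chart (f.toFun x)).dom :=
  (P.chart (f.toFun x)).mapsTo_act _ (P.target_subset _ _ (f.toFun_mem_image hz)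
    ((P.ψ (f.toFun z) (f.toFun x)).map_source hu))

/-- The inverse of the chart change `η_zx`. -/
def ηInv (z x : X) : Eu m → Eu m := fun u =>
  (P.ψ (f.toFun z) (f.toFun x)).symm ((P.chart (f.toFun x)).act (T.ε z x)⁻¹ u)

theorem act_inv_η (hz : z ∈ f.base x) {u : Eu m}
    (hu : u ∈ (P.ψ (f.toFun z) (f.toFun x)).source) :
    (P.chart (f.toFun x)).act (T.ε z x)⁻¹ (T.η z x u) = P.ψ (f.toFun z) (f.toFun x) u :=
  (P.chart (f.toFun x)).act_inv_act _ (P.target_subset _ _ (f.toFun_mem_image hz)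
    ((P.ψ (f.toFun z) (f.toFun x)).map_source hu))

theorem ηInv_η (hz : z ∈ f.base x) {u : Eu m}
    (hu : u ∈ (P.ψ (f.toFun z) (f.toFun x)).source) : T.ηInv z x (T.η z x u) = u := by
  rw [ηInv, T.act_inv_η hz hu, (P.ψ (f.toFun z) (f.toFun x)).left_inv hu]

theorem contDiffAt_ηInv (hz : z ∈ f.base x) {u : Eu m}
    (hu : u ∈ (P.ψ (f.toFun z) (f.toFun x)).source) :
    ContDiffAt ℝ (k : WithTop ℕ∞) (T.ηInv z x) (T.η z x u) := by
  refine ContDiffAt.comp _ ?_ ((P.chart (f.toFun x)).contDiffAt_act _ (T.η_mem_dom hz hu))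
  rw [T.act_inv_η hz hu]
  exact P.contDiffAt_ψ_symm (f.toFun_mem_image hz) ((P.ψ (f.toFun z) (f.toFun x)).map_source hu)

theorem eventually_η_ηInv (hz : z ∈ f.base x) {u : Eu m}
    (hu : u ∈ (P.ψ (f.toFun z) (f.toFun x)).source) :
    ∀ᶠ u' in 𝓝 (T.η z x u), T.η z x (T.ηInv z x u') = u' := by
  have hd := T.η_mem_dom hz hu
  have h1 : ∀ᶠ u' in 𝓝 (T.η z x u), (P.chart (f.toFun x)).act (T.ε z x)⁻¹ u' ∈
      (P.ψ (f.toFun z) (f.toFun x)).target := by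
    apply (P.chart (f.toFun x)).continuousAt_act _ hd
    rw [T.act_inv_η hz hu]
    exact (P.ψ (f.toFun z) (f.toFun x)).open_target.mem_nhds
      ((P.ψ (f.toFun z) (f.toFun x)).map_source hu)
  filter_upwards [h1, (P.chart (f.toFun x)).isOpen_dom.mem_nhds hd] with u' hu' hud
  change (P.chart (f.toFun x)).act (T.ε z x) (P.ψ (f.toFun z) (f.toFun x) (T.ηInv z x u')) = u'
  rw [ηInv, (P.ψ (f.toFun z) (f.toFun x)).right_inv hu', (P.chart (f.toFun x)).act_act_inv _ hud]

theorem differentiableAt_η (hk : 1 ≤ k) (hz : z ∈ f.base x) {u : Eu m}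
    (hu : u ∈ (P.ψ (f.toFun z) (f.toFun x)).source) : DifferentiableAt ℝ (T.η z x) u :=
  (T.contDiffAt_η hz hu).differentiableAt (ENat.coe_withTop_ne_zero hk)

theorem fderiv_ηInv_fderiv_η (hk : 1 ≤ k) (hz : z ∈ f.base x) {u : Eu m}
    (hu : u ∈ (P.ψ (f.toFun z) (f.toFun x)).source) (v : Eu m) :
    fderiv ℝ (T.ηInv z x) (T.η z x u) (fderiv ℝ (T.η z x) u v) = v := by
  have h : T.ηInv z x ∘ T.η z x =ᶠ[𝓝 u] id := by
    filter_upwards [(P.ψ (f.toFun z) (f.toFun x)).open_source.mem_nhds hu] with u' hu'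
    exact T.ηInv_η hz hu'
  have h2 := fderiv_comp u ((T.contDiffAt_ηInv hz hu).differentiableAt
    (ENat.coe_withTop_ne_zero hk)) (T.differentiableAt_η hk hz hu)
  rw [h.fderiv_eq, fderiv_id] at h2
  exact (DFunLike.congr_fun h2 v).symm

theorem fderiv_η_fderiv_ηInv (hk : 1 ≤ k) (hz : z ∈ f.base x) {u : Eu m}
    (hu : u ∈ (P.ψ (f.toFun z) (f.toFun x)).source) (v : Eu m) :
    fderiv ℝ (T.η z x) u (fderiv ℝ (T.ηInv z x) (T.η z x u) v) = v := by
  have h : T.η z x ∘ T.ηInv z x =ᶠ[𝓝 (T.η z x u)] id := T.eventually_η_ηInv hz hu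
  have hd : DifferentiableAt ℝ (T.η z x) (T.ηInv z x (T.η z x u)) := by
    rw [T.ηInv_η hz hu]; exact T.differentiableAt_η hk hz hu
  have h2 := fderiv_comp (T.η z x u) hd ((T.contDiffAt_ηInv hz hu).differentiableAt
    (ENat.coe_withTop_ne_zero hk))
  rw [h.fderiv_eq, fderiv_id, T.ηInv_η hz hu] at h2
  exact (DFunLike.congr_fun h2 v).symm

/-- `Θ_θ` is the relation that moves `ε` past the group elements in the equivariance of the
embedding of `P`. -/
theorem η_act (hz : z ∈ f.base x) (γ : (O.chart z).Γ) {u : Eu m}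
    (hu : u ∈ (P.ψ (f.toFun z) (f.toFun x)).source) :
    T.η z x ((P.chart (f.toFun z)).act (f.Θ z γ) u) =
      (P.chart (f.toFun x)).act (f.Θ x (O.θ z x γ)) (T.η z x u) := by
  have hz' := f.toFun_mem_image hz
  have hd := P.target_subset _ _ hz' ((P.ψ (f.toFun z) (f.toFun x)).map_source hu)
  change (P.chart (f.toFun x)).act (T.ε z x) (P.ψ (f.toFun z) (f.toFun x) _) =
    (P.chart (f.toFun x)).act _ ((P.chart (f.toFun x)).act (T.ε z x) _)
  rw [P.ψ_act _ _ hz' _ _ hu, ← (P.chart (f.toFun x)).act_mul _ _ _ hd,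
    ← (P.chart (f.toFun x)).act_mul _ _ _ hd, T.Θ_θ z x hz]

theorem fderiv_η_act (hk : 1 ≤ k) (hz : z ∈ f.base x) (γ : (O.chart z).Γ) {u : Eu m}
    (hu : u ∈ (P.ψ (f.toFun z) (f.toFun x)).source) (v : Eu m) :
    fderiv ℝ (T.η z x) ((P.chart (f.toFun z)).act (f.Θ z γ) u)
        (fderiv ℝ ((P.chart (f.toFun z)).act (f.Θ z γ)) u v) =
      fderiv ℝ ((P.chart (f.toFun x)).act (f.Θ x (O.θ z x γ))) (T.η z x u)
        (fderiv ℝ (T.η z x) u v) := by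
  have hz' := f.toFun_mem_image hz
  have hu' := P.mapsTo_act_source _ _ hz' (f.Θ z γ) hu
  have h : T.η z x ∘ (P.chart (f.toFun z)).act (f.Θ z γ) =ᶠ[𝓝 u]
      (P.chart (f.toFun x)).act (f.Θ x (O.θ z x γ)) ∘ T.η z x := by
    filter_upwards [(P.ψ (f.toFun z) (f.toFun x)).open_source.mem_nhds hu] with u' hu'
    exact T.η_act hz γ hu'
  have h2 := h.fderiv_eq (𝕜 := ℝ)
  rw [fderiv_comp _ (T.differentiableAt_η hk hz hu')
    ((P.chart (f.toFun z)).differentiableAt_act hk _ (P.source_subset _ _ hz' hu)),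
    fderiv_comp _ ((P.chart (f.toFun x)).differentiableAt_act hk _ (T.η_mem_dom hz hu))
    (T.differentiableAt_η hk hz hu)] at h2
  exact DFunLike.congr_fun h2 v

theorem lift_ψ_center (hz : z ∈ f.base x) :
    f.lift x (O.ψ z x (O.chart z).center) = T.η z x (f.lift z (O.chart z).center) :=
  (T.lift_ψ z x hz).self_of_nhds

theorem bundleAct_mul (hk : 1 ≤ k) (γ δ : (O.chart x).Γ) {y : Eu n} (hy : y ∈ f.dom x)
    (v : Eu m) :
    T.bundleAct x (γ * δ) (y, v) = T.bundleAct x γ (T.bundleAct x δ (y, v)) := by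
  ext1
  · exact (O.chart x).act_mul _ _ _ (f.dom_subset x hy)
  · simp only [bundleAct]
    rw [map_mul, (P.chart (f.toFun x)).fderiv_act_mul hk _ _ (f.mapsTo_lift x hy),
      f.lift_act x δ y hy]
    rfl

theorem bundleAct_one {y : Eu n} (hy : y ∈ f.dom x) (v : Eu m) :
    T.bundleAct x 1 (y, v) = (y, v) := by
  ext1
  · exact (O.chart x).act_one _ (f.dom_subset x hy)
  · simp only [bundleAct]
    rw [map_one, (P.chart (f.toFun x)).fderiv_act_one (f.mapsTo_lift x hy)]
    rfl

theorem bundleAct_inv_bundleAct (hk : 1 ≤ k) (γ : (O.chart x).Γ) {y : Eu n} (hy : y ∈ f.dom x)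
    (v : Eu m) : T.bundleAct x γ⁻¹ (T.bundleAct x γ (y, v)) = (y, v) := by
  rw [← T.bundleAct_mul hk _ _ hy, inv_mul_cancel, T.bundleAct_one hy]

/-- The chart changes of the pullback are equivariant, at the centre of the smaller chart. -/
theorem bundleψ_bundleAct_center (hk : 1 ≤ k) (hz : z ∈ f.base x) (γ : (O.chart z).Γ) (v : Eu m) :
    T.bundleψ z x (T.bundleAct z γ ((O.chart z).center, v)) =
      T.bundleAct x (O.θ z x γ) (T.bundleψ z x ((O.chart z).center, v)) := by
  ext1
  · exact O.ψ_act z x (f.base_subset hz) γ _ (O.center_mem_source z x (f.base_subset hz))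
  · simp only [bundleAct, bundleψ]
    rw [f.lift_act z γ _ (f.center_mem_dom z), T.lift_ψ_center hz]
    exact T.fderiv_η_act hk hz γ (f.lift_center_mem_source hz) v

theorem bundleψ_center_injective (hk : 1 ≤ k) (hz : z ∈ f.base x) {v v' : Eu m}
    (h : T.bundleψ z x ((O.chart z).center, v) = T.bundleψ z x ((O.chart z).center, v')) :
    v = v' := by
  have h2 := congrArg Prod.snd h
  simp only [bundleψ] at h2
  rw [← T.fderiv_ηInv_fderiv_η hk hz (f.lift_center_mem_source hz) v, h2,
    T.fderiv_ηInv_fderiv_η hk hz (f.lift_center_mem_source hz)]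

/-- The chart change from a chart to itself is the action of a group element, near the centre. -/
theorem exists_bundleψ_self_eq (x : X) : ∃ δ, ∀ᶠ u in 𝓝 (O.chart x).center,
    ∀ v, T.bundleψ x x (u, v) = T.bundleAct x δ (u, v) := by
  have hx := f.mem_base_self x
  have hx' := f.base_subset hx
  -- Coherence with all three base points equal to `x` says ψ ∘ ψ = δ · ψ and η ∘ η = Θ(δ) · η near
  -- the centres. Evaluation at ψ⁻¹(u) and at `ηInv`(u), which stay near the centres because these
  -- are fixed, cancels one factor.
  obtain ⟨δ, h1, h2⟩ := (T.cocycle x x hx).self_of_nhds x (O.chart x).proj_center.symm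
  refine ⟨δ, ?_⟩
  have hsrc := O.center_mem_source x x hx'
  have hcen := O.ψ_self_center x
  have hη : T.η x x (f.lift x (O.chart x).center) = f.lift x (O.chart x).center := by
    rw [← T.lift_ψ_center hx, hcen]
  have e1 : ∀ᶠ u in 𝓝 (O.chart x).center, O.ψ x x u = (O.chart x).act δ u := by
    have hct : (O.chart x).center ∈ (O.ψ x x).target := by
      have := (O.ψ x x).map_source hsrc
      rwa [hcen] at this
    have ht : Tendsto (O.ψ x x).symm (𝓝 (O.chart x).center) (𝓝 (O.chart x).center) := by
      have h3 := (O.ψ x x).continuousAt_symm hct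
      have h4 : (O.ψ x x).symm (O.chart x).center = (O.chart x).center := by
        conv_lhs => rw [← hcen]
        exact (O.ψ x x).left_inv hsrc
      rw [ContinuousAt, h4] at h3
      exact h3
    filter_upwards [ht h1, (O.ψ x x).open_target.mem_nhds hct] with u hu hut
    have hu' : O.ψ x x (O.ψ x x ((O.ψ x x).symm u)) =
      (O.chart x).act δ (O.ψ x x ((O.ψ x x).symm u)) := hu
    rwa [(O.ψ x x).right_inv hut] at hu'
  have e2 : ∀ᶠ u in 𝓝 (f.lift x (O.chart x).center),
      T.η x x u = (P.chart (f.toFun x)).act (f.Θ x δ) u := by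
    have hs := f.lift_center_mem_source hx
    have ht : Tendsto (T.ηInv x x) (𝓝 (f.lift x (O.chart x).center))
        (𝓝 (f.lift x (O.chart x).center)) := by
      have h3 := (T.contDiffAt_ηInv hx hs).continuousAt
      rw [ContinuousAt, T.ηInv_η hx hs, hη] at h3
      exact h3
    have h4 := T.eventually_η_ηInv hx hs
    rw [hη] at h4
    rw [← f.lift_center] at h2
    filter_upwards [ht h2, h4] with u hu hu2
    have hu' : T.η x x (T.η x x (T.ηInv x x u)) =
      (P.chart (f.toFun x)).act (f.Θ x δ) (T.η x x (T.ηInv x x u)) := hu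
    rwa [hu2] at hu'
  filter_upwards [e1, (f.continuousAt_lift (f.center_mem_dom x)).eventually e2.eventually_nhds]
    with u hu hu2 v
  ext1
  · exact hu
  · simp only [bundleψ, bundleAct]
    rw [EventuallyEq.fderiv_eq hu2]

/-- The vectors over `w̃` in the chart at `w` which are identified with the given point of a chart of
the pullback. -/
def fibreVectors (p : T.Pre) (w : X) : Set (Eu m) :=
  {u | (O.chart p.1).proj p.2.1 = w ∧
    ∃ γ, ((p.2.1 : Eu n), p.2.2) = T.bundleAct p.1 γ (T.bundleψ w p.1 ((O.chart w).center, u))}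

theorem fibreVectors_subset_of_act (hk : 1 ≤ k) (γ : (O.chart x).Γ) (y y' : f.dom x)
    (v v' : Eu m) (h : ((y' : Eu n), v') = T.bundleAct x γ ((y : Eu n), v)) (w : X) :
    T.fibreVectors ⟨x, (y, v)⟩ w ⊆ T.fibreVectors ⟨x, (y', v')⟩ w := by
  rintro u ⟨hw, δ, hδ⟩
  have hw' : w ∈ f.base x := hw ▸ f.proj_mem_base y.2
  refine ⟨?_, γ * δ, ?_⟩
  · rw [← hw]
    have h1 : (y' : Eu n) = (O.chart x).act γ y := congrArg Prod.fst h
    exact (((O.chart x).proj_eq_iff _ (f.dom_subset x y.2) _ (f.dom_subset x y'.2)).2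
      ⟨γ, h1.symm⟩).symm
  · change ((y' : Eu n), v') = _
    rw [h]
    change _ = T.bundleAct x (γ * δ) (O.ψ w x (O.chart w).center, _)
    rw [T.bundleAct_mul hk _ _ (f.ψ_center_mem_dom hw')]
    exact congrArg _ hδ

/-- This makes `fibreVectors` descend to the quotient and so separate its points. For a `change`
identification, an element relating two vectors over ψ(w̃) stabilizes that point, so it comes from
the group at `w` by `exists_θ_eq`; the self-change of the chart at `w` contributes the factor `δ₀`,
which is inserted or removed. -/
theorem fibreVectors_eq_of_rel (hk : 1 ≤ k) {p q : T.Pre} (h : T.Rel p q) :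
    T.fibreVectors p = T.fibreVectors q := by
  funext w
  cases h with
  | act x γ y y' v v' h =>
    refine (T.fibreVectors_subset_of_act hk γ y y' v v' h w).antisymm
      (T.fibreVectors_subset_of_act hk γ⁻¹ y' y v' v ?_ w)
    rw [h, T.bundleAct_inv_bundleAct hk γ y.2]
  | change w₀ x hw₀ y y' v v' hy h =>
    obtain ⟨y, hyd⟩ := y
    simp only at hy h
    subst hy
    obtain ⟨δ₀, hδ₀⟩ := T.exists_bundleψ_self_eq w₀
    have hδ₀ := hδ₀.self_of_nhds
    have hproj : (O.chart x).proj y' = w₀ := by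
      have h1 : (y' : Eu n) = O.ψ w₀ x (O.chart w₀).center := congrArg Prod.fst h
      rw [h1, O.proj_ψ_center (f.base_subset hw₀)]
    ext u
    constructor
    · rintro ⟨hw, γ, hγ⟩
      have hw : w₀ = w := by rw [← hw]; exact (O.chart w₀).proj_center.symm
      subst hw
      refine ⟨hproj, O.θ w₀ x (γ * δ₀), ?_⟩
      change ((y' : Eu n), v') = _
      rw [h, ← T.bundleψ_bundleAct_center hk hw₀, T.bundleAct_mul hk _ _ hyd]
      rw [← hδ₀ u]
      exact congrArg _ hγ
    · rintro ⟨hw, δ, hδ⟩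
      have hw : w₀ = w := by rw [← hw]; exact hproj.symm
      subst hw
      refine ⟨(O.chart w₀).proj_center, ?_⟩
      have hδ' : T.bundleψ w₀ x ((O.chart w₀).center, v) =
        T.bundleAct x δ (T.bundleψ w₀ x ((O.chart w₀).center, u)) := h.symm.trans hδ
      obtain ⟨γ, rfl⟩ := O.exists_θ_eq hk (f.base_subset hw₀) (δ := δ)
        (congrArg Prod.fst hδ').symm
      rw [← T.bundleψ_bundleAct_center hk hw₀] at hδ'
      have hc : T.bundleAct w₀ γ ((O.chart w₀).center, u) =
          ((O.chart w₀).center, (T.bundleAct w₀ γ ((O.chart w₀).center, u)).2) := by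
        ext1
        · exact (O.chart w₀).act_center γ
        · rfl
      rw [hc] at hδ'
      have hv := T.bundleψ_center_injective hk hw₀ hδ'
      refine ⟨γ * δ₀⁻¹, ?_⟩
      change ((O.chart w₀).center, v) = T.bundleAct w₀ (γ * δ₀⁻¹) (T.bundleψ w₀ w₀ (_, u))
      rw [hδ₀ u]
      have hd : (T.bundleAct w₀ δ₀ ((O.chart w₀).center, u)).1 ∈ f.dom w₀ :=
        f.act_mem_dom _ hyd
      have := T.bundleAct_mul hk γ δ₀⁻¹ hd (T.bundleAct w₀ δ₀ ((O.chart w₀).center, u)).2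
      rw [Prod.mk.eta] at this
      rw [this, T.bundleAct_inv_bundleAct hk _ hyd, hc, ← hv]

/-- Two points of a chart of the pullback are identified exactly if they are in the same orbit. -/
theorem exists_bundleAct_eq_of_toTotal_eq (hk : 1 ≤ k) {q q' : Eu n × Eu m} {h : q.1 ∈ f.dom x}
    {h' : q'.1 ∈ f.dom x} (he : T.toTotal x q h = T.toTotal x q' h') :
    ∃ γ, q' = T.bundleAct x γ q := by
  have h1 : T.fibreVectors ⟨x, (⟨q.1, h⟩, q.2)⟩ = T.fibreVectors ⟨x, (⟨q'.1, h'⟩, q'.2)⟩ :=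
    congrArg (Quot.lift T.fibreVectors fun _ _ => T.fibreVectors_eq_of_rel hk) he
  set w := (O.chart x).proj q.1 with hw
  have hwx : w ∈ f.base x := f.proj_mem_base h
  obtain ⟨γ, hγ⟩ := f.exists_act_ψ_center_eq (w := w) h rfl
  have hsrc := f.lift_center_mem_source hwx
  have hpd := f.ψ_center_mem_dom hwx
  -- The differential of `η w x` is invertible, so `q` is reached from some vector `u` over w̃. Then
  -- `u` lies in the invariant of `q`, hence in that of `q'`, and the two expressions through `u`
  -- yield the group element.
  obtain ⟨u, hu⟩ : ∃ u, q = T.bundleAct x γ (T.bundleψ w x ((O.chart w).center, u)) := by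
    refine ⟨fderiv ℝ (T.ηInv w x) (T.η w x (f.lift w (O.chart w).center))
      (T.bundleAct x γ⁻¹ q).2, ?_⟩
    have h2 : T.bundleψ w x ((O.chart w).center, fderiv ℝ (T.ηInv w x)
        (T.η w x (f.lift w (O.chart w).center)) (T.bundleAct x γ⁻¹ q).2) =
        T.bundleAct x γ⁻¹ q := by
      ext1
      · change O.ψ w x (O.chart w).center = (O.chart x).act γ⁻¹ q.1
        rw [← hγ, (O.chart x).act_inv_act _ (f.dom_subset x hpd)]
      · exact T.fderiv_η_fderiv_ηInv hk hwx hsrc _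
    rw [h2]
    have := T.bundleAct_inv_bundleAct hk γ⁻¹ h q.2
    rw [inv_inv] at this
    exact this.symm
  have hmem : u ∈ T.fibreVectors ⟨x, (⟨q.1, h⟩, q.2)⟩ w := ⟨rfl, γ, hu⟩
  rw [h1] at hmem
  obtain ⟨-, γ', hγ'⟩ := hmem
  have hγ' : q' = T.bundleAct x γ' (T.bundleψ w x ((O.chart w).center, u)) := hγ'
  refine ⟨γ' * γ⁻¹, ?_⟩
  have h3 : T.bundleAct x (γ' * γ⁻¹) q = T.bundleAct x γ' (T.bundleAct x γ⁻¹ q) :=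
    T.bundleAct_mul hk γ' γ⁻¹ h q.2
  have h4 : T.bundleAct x γ⁻¹ (T.bundleAct x γ (T.bundleψ w x ((O.chart w).center, u))) =
    T.bundleψ w x ((O.chart w).center, u) := T.bundleAct_inv_bundleAct hk γ hpd _
  rw [h3, hu, h4, hγ']

theorem toTotal_bundleAct (γ : (O.chart x).Γ) {q : Eu n × Eu m} (h : q.1 ∈ f.dom x)
    (h' : (T.bundleAct x γ q).1 ∈ f.dom x) :
    T.toTotal x (T.bundleAct x γ q) h' = T.toTotal x q h :=
  (Quot.sound (Rel.act x γ ⟨q.1, h⟩ ⟨_, h'⟩ q.2 _ rfl)).symm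

theorem toTotal_bundleψ_center (hw : w ∈ f.base x) (v : Eu m)
    (h' : (T.bundleψ w x ((O.chart w).center, v)).1 ∈ f.dom x) :
    T.toTotal x (T.bundleψ w x ((O.chart w).center, v)) h' =
      T.toTotal w ((O.chart w).center, v) (f.center_mem_dom w) :=
  (Quot.sound (Rel.change w x hw ⟨_, f.center_mem_dom w⟩ ⟨_, h'⟩ v _ rfl rfl)).symm

end Transitions

end CompleteOrbifoldMap

/-! ### Orbisections as compatible families of representatives -/

namespace CompleteOrbifoldMap

variable {n m : ℕ} {k : ℕ∞} {X Y : Type*} [TopologicalSpace X] [TopologicalSpace Y]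
  {O : Orbifold n k X} {P : Orbifold m k Y} {f : CompleteOrbifoldMap O P} {w z x : X}

namespace Transitions

variable (T : f.Transitions) {r : ℕ∞}

/-- The families of local representatives of orbisections: `C^r`, equivariant, and compatible with the
chart changes at the centres of the charts. -/
noncomputable def sectionSpace (r : ℕ∞) : Submodule ℝ (X → Eu n → Eu m) where
  carrier := {s | (∀ x y, y ∉ f.dom x → s x y = 0) ∧
    (∀ x, ContDiffOn ℝ (r : WithTop ℕ∞) (s x) (f.dom x)) ∧
    (∀ x γ, ∀ y ∈ f.dom x, s x ((O.chart x).act γ y) =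
      fderiv ℝ ((P.chart (f.toFun x)).act (f.Θ x γ)) (f.lift x y) (s x y)) ∧
    ∀ w x, w ∈ f.base x → s x (O.ψ w x (O.chart w).center) =
      fderiv ℝ (T.η w x) (f.lift w (O.chart w).center) (s w (O.chart w).center)}
  zero_mem' := ⟨fun _ _ _ => rfl, fun _ => contDiffOn_const, fun _ _ _ _ => by simp,
    fun _ _ _ => by simp⟩
  add_mem' := by
    rintro s t ⟨h1, h2, h3, h4⟩ ⟨k1, k2, k3, k4⟩
    refine ⟨fun x y hy => ?_, fun x => (h2 x).add (k2 x), fun x γ y hy => ?_, fun w x hw => ?_⟩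
    · simp [h1 x y hy, k1 x y hy]
    · simp [h3 x γ y hy, k3 x γ y hy]
    · simp [h4 w x hw, k4 w x hw]
  smul_mem' := by
    rintro a s ⟨h1, h2, h3, h4⟩
    refine ⟨fun x y hy => ?_, fun x => (h2 x).const_smul a, fun x γ y hy => ?_, fun w x hw => ?_⟩
    · simp [h1 x y hy]
    · simp [h3 x γ y hy]
    · simp [h4 w x hw]

variable {T}

/-- The homomorphism `Θ'` is arbitrary in the definition, but the first components force it to be
the identity, as the group acts effectively on `f.dom x`. -/
theorem Orbisection.repr_act (σ : T.Orbisection r) (γ : (O.chart x).Γ) {y : Eu n}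
    (hy : y ∈ f.dom x) : σ.repr x ((O.chart x).act γ y) =
      fderiv ℝ ((P.chart (f.toFun x)).act (f.Θ x γ)) (f.lift x y) (σ.repr x y) := by
  obtain ⟨Θ', hΘ'⟩ := σ.equivariant x
  have h : Θ' γ = γ := by
    apply inv_mul_eq_one.1
    apply (f.isSubchart_dom x).effective
    intro u hu
    have h1 : (O.chart x).act γ u = (O.chart x).act (Θ' γ) u := congrArg Prod.fst (hΘ' γ u hu)
    rw [(O.chart x).act_mul _ _ _ (f.dom_subset x hu), h1,
      (O.chart x).act_inv_act _ (f.dom_subset x hu)]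
  have h2 := congrArg Prod.snd (hΘ' γ y hy)
  rw [h] at h2
  exact h2

theorem Orbisection.bundleAct_repr (σ : T.Orbisection r) (γ : (O.chart x).Γ) {y : Eu n}
    (hy : y ∈ f.dom x) : T.bundleAct x γ (y, σ.repr x y) =
      ((O.chart x).act γ y, σ.repr x ((O.chart x).act γ y)) := by
  rw [σ.repr_act γ hy]
  rfl

/-- The values of an orbisection in a chart are determined by those in the quotient. -/
theorem Orbisection.eq_repr_of_toTotal_eq (hk : 1 ≤ k) (σ : T.Orbisection r) {y : Eu n}
    (hy : y ∈ f.dom x) {v : Eu m}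
    (h : T.toTotal x (y, v) hy = σ.toFun ((O.chart x).proj y)) : v = σ.repr x y := by
  rw [← σ.toTotal_repr x y hy] at h
  -- The element `γ` fixes `y`; by equivariance of the section it then fixes the vector as well.
  obtain ⟨γ, hγ⟩ := T.exists_bundleAct_eq_of_toTotal_eq hk h.symm
  rw [σ.bundleAct_repr γ hy] at hγ
  have h1 : y = (O.chart x).act γ y := congrArg Prod.fst hγ
  have h2 : v = σ.repr x ((O.chart x).act γ y) := congrArg Prod.snd hγ
  rwa [← h1] at h2

theorem Orbisection.repr_ψ_center (hk : 1 ≤ k) (σ : T.Orbisection r) (hw : w ∈ f.base x) :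
    σ.repr x (O.ψ w x (O.chart w).center) =
      fderiv ℝ (T.η w x) (f.lift w (O.chart w).center) (σ.repr w (O.chart w).center) := by
  symm
  have hd := f.ψ_center_mem_dom hw
  apply σ.eq_repr_of_toTotal_eq hk hd
  have h := T.toTotal_bundleψ_center hw (σ.repr w (O.chart w).center) hd
  have h2 := σ.toTotal_repr w _ (f.center_mem_dom w)
  rw [O.proj_ψ_center (f.base_subset hw)]
  rw [(O.chart w).proj_center] at h2
  exact h.trans h2

theorem Orbisection.repr_mem (hk : 1 ≤ k) (σ : T.Orbisection r) : σ.repr ∈ T.sectionSpace r :=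
  ⟨σ.repr_eq_zero, σ.contDiffOn_repr, fun _ γ _ hy => σ.repr_act γ hy,
    fun _ _ hw => σ.repr_ψ_center hk hw⟩

/-- Every point over `w` in the chart at `x` is a translate of ψ(w̃), so equivariance and
compatibility at the centres suffice for the representatives to glue to one map on the base. -/
theorem toTotal_eq_of_mem_sectionSpace {s : X → Eu n → Eu m} (hs : s ∈ T.sectionSpace r)
    {y : Eu n} (hy : y ∈ f.dom x) (hw : (O.chart x).proj y = w) :
    T.toTotal x (y, s x y) hy =
      T.toTotal w ((O.chart w).center, s w (O.chart w).center) (f.center_mem_dom w) := by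
  obtain ⟨h1, h2, h3, h4⟩ := hs
  have hwx : w ∈ f.base x := hw ▸ f.proj_mem_base hy
  obtain ⟨γ, rfl⟩ := f.exists_act_ψ_center_eq hy hw
  have hd := f.ψ_center_mem_dom hwx
  rw [← T.toTotal_bundleψ_center hwx (s w (O.chart w).center) hd,
    ← T.toTotal_bundleAct γ (q := T.bundleψ w x ((O.chart w).center, s w (O.chart w).center)) hd
      (f.act_mem_dom γ hd)]
  congr 1
  ext1
  · rfl
  · change s x _ = fderiv ℝ ((P.chart (f.toFun x)).act (f.Θ x γ)) (f.lift x _) _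
    rw [h3 x γ _ hd, h4 w x hwx]
    rfl

/-- The orbisection with the given local representatives. -/
noncomputable def sectionOf (s : X → Eu n → Eu m) (hs : s ∈ T.sectionSpace r) :
    T.Orbisection r where
  toFun w := T.toTotal w ((O.chart w).center, s w (O.chart w).center) (f.center_mem_dom w)
  continuous_toFun := by
    rw [continuous_iff_continuousAt]
    intro x
    let F : X → T.Total := fun w =>
      T.toTotal w ((O.chart w).center, s w (O.chart w).center) (f.center_mem_dom w)
    have hc := f.center_mem_dom x
    -- Since the projection is open, continuity at `x` can be tested after composition with it, at
    -- the centre.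
    have h1 : 𝓝 x ≤ map (O.chart x).proj (𝓝 (O.chart x).center) := by
      intro V hV
      obtain ⟨U, hUV, hU, hcU⟩ := mem_nhds_iff.1 (mem_map.1 hV)
      have hopen := (O.chart x).isOpen_image_proj (U ∩ (O.chart x).dom) inter_subset_right
        (hU.inter (O.chart x).isOpen_dom)
      refine mem_of_superset (hopen.mem_nhds
        ⟨_, ⟨hcU, (O.chart x).center_mem⟩, (O.chart x).proj_center⟩) ?_
      rintro _ ⟨u, hu, rfl⟩
      exact hUV hu.1
    have h2 : Continuous fun y : f.dom x => T.toTotal x ((y : Eu n), s x y) y.2 := by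
      refine continuous_quot_mk.comp (continuous_sigmaMk.comp (continuous_id.prodMk ?_))
      exact (hs.2.1 x).continuousOn.domRestrict
    have h3 : Tendsto (F ∘ (O.chart x).proj) (𝓝 (O.chart x).center) (𝓝 (F x)) := by
      rw [← map_nhds_subtype_coe_eq_nhds hc (f.dom_mem_nhds hc), tendsto_map'_iff]
      have h4 := h2.tendsto ⟨_, hc⟩
      have h5 : (fun y : f.dom x => T.toTotal x ((y : Eu n), s x y) y.2) =
          (F ∘ (O.chart x).proj) ∘ Subtype.val := by
        funext y
        exact toTotal_eq_of_mem_sectionSpace hs y.2 rfl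
      rw [h5] at h4
      exact h4
    exact (tendsto_map'_iff.2 h3).mono_left h1
  bundleProj_toFun w := (O.chart w).proj_center
  repr := s
  repr_eq_zero := hs.1
  contDiffOn_repr := hs.2.1
  toTotal_repr x y hy := toTotal_eq_of_mem_sectionSpace hs hy rfl
  equivariant x := ⟨MonoidHom.id _, fun γ y hy => by
    rw [hs.2.2.1 x γ y hy]
    rfl⟩

theorem Orbisection.repr_injective : Function.Injective (Orbisection.repr (T := T) (r := r)) := by
  intro σ τ h
  refine Orbisection.ext ?_ h
  funext x
  have h1 := σ.toTotal_repr x _ (f.center_mem_dom x)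
  have h2 := τ.toTotal_repr x _ (f.center_mem_dom x)
  rw [(O.chart x).proj_center] at h1 h2
  rw [← h1, ← h2, h]

variable (T) in
/-- Orbisections correspond to compatible families of local representatives. -/
noncomputable def orbisectionEquiv (hk : 1 ≤ k) (r : ℕ∞) : T.Orbisection r ≃ T.sectionSpace r where
  toFun σ := ⟨σ.repr, σ.repr_mem hk⟩
  invFun s := sectionOf s.1 s.2
  left_inv _ := Orbisection.repr_injective rfl
  right_inv _ := rfl

/-- Near the centre of a chart, orbisections are compatible with the chart changes. -/
theorem eventually_repr_ψ (hk : 1 ≤ k) (T : f.Transitions) (r : ℕ∞) (hz : z ∈ f.base x) :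
    ∀ᶠ y in 𝓝 (O.chart z).center, ∀ σ : T.Orbisection r,
      σ.repr x (O.ψ z x y) = fderiv ℝ (T.η z x) (f.lift z y) (σ.repr z y) := by
  have hz' := f.base_subset hz
  have hc := f.center_mem_dom z
  have hsrc := O.center_mem_source z x hz'
  have e1 : ∀ᶠ y in 𝓝 (O.chart z).center, (O.chart z).proj y ∈ f.base x := by
    apply f.continuousAt_proj hc
    rw [(O.chart z).proj_center]
    exact (f.isOpen_base x).mem_nhds hz
  have e2 : ∀ᶠ y in 𝓝 (O.chart z).center,
      f.lift z y ∈ (P.ψ (f.toFun z) (f.toFun x)).source :=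
    f.continuousAt_lift hc ((P.ψ (f.toFun z) (f.toFun x)).open_source.mem_nhds
      (f.lift_center_mem_source hz))
  -- This is needed at `y₀` below, a translate of `y` by an element that depends on `y`; hence all
  -- elements of the finite group are treated at once.
  have e3 : ∀ᶠ y in 𝓝 (O.chart z).center, ∀ γ : (O.chart z).Γ,
      f.lift x (O.ψ z x ((O.chart z).act γ y)) = T.η z x (f.lift z ((O.chart z).act γ y)) := by
    rw [eventually_all]
    intro γ
    have := (O.chart z).continuousAt_act γ (O.chart z).center_mem
    rw [ContinuousAt, (O.chart z).act_center] at this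
    exact this.eventually (T.lift_ψ z x hz)
  filter_upwards [T.cocycle z x hz, e1, e2, e3, (O.ψ z x).open_source.mem_nhds hsrc,
    f.dom_mem_nhds hc] with y hcoc hyx hyP hlift hys hyd σ
  -- The base point varies with `y`. Coherence for the charts at `w`, `z` and `x`, differentiated at
  -- the centre over `w`, gives the formula at the point `y₀` over `w`; equivariance carries it from
  -- `y₀` to its translate `y`.
  set w := (O.chart z).proj y with hw
  have hwz : w ∈ f.base z := f.proj_mem_base hyd
  obtain ⟨δ, h1, h2⟩ := hcoc w hw
  have hwP := f.lift_center_mem_source hwz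
  have hwP' := f.lift_center_mem_source hyx
  obtain ⟨γ, hγ⟩ := f.exists_act_ψ_center_eq hyd hw.symm
  set y₀ := O.ψ w z (O.chart w).center with hy₀
  have hy₀d : y₀ ∈ f.dom z := f.ψ_center_mem_dom hwz
  have hγ' : (O.chart z).act γ⁻¹ y = y₀ := by
    rw [← hγ, (O.chart z).act_inv_act _ (f.dom_subset z hy₀d)]
  have hy₀s : y₀ ∈ (O.ψ z x).source := hγ' ▸ O.mapsTo_act_source z x hz' γ⁻¹ hys
  have hy₀P : f.lift z y₀ ∈ (P.ψ (f.toFun z) (f.toFun x)).source := by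
    rw [← hγ', f.lift_act z _ y hyd]
    exact P.mapsTo_act_source _ _ (f.toFun_mem_image hz) _ hyP
  have hlift₀ : f.lift x (O.ψ z x y₀) = T.η z x (f.lift z y₀) := by
    have := hlift γ⁻¹
    rwa [hγ'] at this
  have hη₀ : f.lift z y₀ = T.η w z (f.lift w (O.chart w).center) := T.lift_ψ_center hwz
  have hψx : O.ψ z x y₀ = (O.chart x).act δ (O.ψ w x (O.chart w).center) := h1.self_of_nhds
  have hwxd : O.ψ w x (O.chart w).center ∈ f.dom x := f.ψ_center_mem_dom hyx
  have hd : fderiv ℝ (T.η z x) (f.lift z y₀) (fderiv ℝ (T.η w z) (f.lift w (O.chart w).center)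
        (σ.repr w (O.chart w).center)) =
      fderiv ℝ ((P.chart (f.toFun x)).act (f.Θ x δ)) (f.lift x (O.ψ w x (O.chart w).center))
        (fderiv ℝ (T.η w x) (f.lift w (O.chart w).center) (σ.repr w (O.chart w).center)) := by
    rw [← f.lift_center] at h2
    have h3 : T.η z x ∘ T.η w z =ᶠ[𝓝 (f.lift w (O.chart w).center)]
      (P.chart (f.toFun x)).act (f.Θ x δ) ∘ T.η w x := h2
    have h4 := h3.fderiv_eq (𝕜 := ℝ)
    rw [fderiv_comp _ (hη₀ ▸ T.differentiableAt_η hk hz hy₀P) (T.differentiableAt_η hk hwz hwP),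
      fderiv_comp _ ((P.chart (f.toFun x)).differentiableAt_act hk _ (T.η_mem_dom hyx hwP'))
        (T.differentiableAt_η hk hyx hwP')] at h4
    rw [hη₀, T.lift_ψ_center hyx]
    exact DFunLike.congr_fun h4 _
  have main₀ : σ.repr x (O.ψ z x y₀) = fderiv ℝ (T.η z x) (f.lift z y₀) (σ.repr z y₀) := by
    rw [hψx, σ.repr_act δ hwxd, σ.repr_ψ_center hk hyx, hy₀, σ.repr_ψ_center hk hwz, ← hd]
  have hψy₀d : O.ψ z x y₀ ∈ f.dom x := by rw [hψx]; exact f.act_mem_dom δ hwxd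
  rw [← hγ, O.ψ_act z x hz' γ _ hy₀s, σ.repr_act _ hψy₀d, main₀, σ.repr_act γ hy₀d,
    f.lift_act z γ _ hy₀d, T.fderiv_η_act hk hz γ hy₀P, hlift₀]

end Transitions

end CompleteOrbifoldMap

/-! ### Estimates for derivatives of compositions and products -/

section IteratedDerivatives

variable {E F G : Type*} [NormedAddCommGroup E] [NormedSpace ℝ E] [NormedAddCommGroup F]
  [NormedSpace ℝ F] [NormedAddCommGroup G] [NormedSpace ℝ G]

theorem ContDiffAt.exists_isOpen_contDiffOn {f : E → F} {s : ℕ} {x : E} (hf : ContDiffAt ℝ s f x) :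
    ∃ U, IsOpen U ∧ x ∈ U ∧ ContDiffOn ℝ s f U := by
  obtain ⟨u, hu, hfu⟩ := hf.contDiffOn le_rfl (by simp)
  obtain ⟨U, hUu, hU, hxU⟩ := mem_nhds_iff.1 hu
  exact ⟨U, hU, hxU, hfu.mono hUu⟩

/-- For finite `s`, being C^s at a point means being C^s on an open neighbourhood, where derivatives
within the set are the ordinary ones. -/
theorem norm_iteratedFDeriv_comp_le_of_contDiffAt {g : F → G} {f : E → F} {s : ℕ} {x : E}
    (hg : ContDiffAt ℝ s g (f x)) (hf : ContDiffAt ℝ s f x) {C D : ℝ}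
    (hC : ∀ i ≤ s, ‖iteratedFDeriv ℝ i g (f x)‖ ≤ C)
    (hD : ∀ i, 1 ≤ i → i ≤ s → ‖iteratedFDeriv ℝ i f x‖ ≤ D ^ i) :
    ‖iteratedFDeriv ℝ s (g ∘ f) x‖ ≤ s.factorial * C * D ^ s := by
  obtain ⟨V, hV, hxV, hgV⟩ := hg.exists_isOpen_contDiffOn
  obtain ⟨U, hU, hxU, hfU⟩ := hf.exists_isOpen_contDiffOn
  have hW : IsOpen (U ∩ f ⁻¹' V) := hfU.continuousOn.isOpen_inter_preimage hU hV
  have hxW : x ∈ U ∩ f ⁻¹' V := ⟨hxU, hxV⟩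
  have h := norm_iteratedFDerivWithin_comp_le (n := s) hgV (hfU.mono inter_subset_left) le_rfl
    hV.uniqueDiffOn hW.uniqueDiffOn (fun _ h => h.2) hxW (C := C) (D := D)
    (fun i hi => by rw [iteratedFDerivWithin_of_isOpen i hV hxV]; exact hC i hi)
    (fun i h1 hi => by rw [iteratedFDerivWithin_of_isOpen i hW hxW]; exact hD i h1 hi)
  rwa [iteratedFDerivWithin_of_isOpen s hW hxW] at h

theorem norm_iteratedFDeriv_clm_apply_of_contDiffAt {f : E → F →L[ℝ] G} {g : E → F} {s : ℕ} {x : E}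
    (hf : ContDiffAt ℝ s f x) (hg : ContDiffAt ℝ s g x) :
    ‖iteratedFDeriv ℝ s (fun y => f y (g y)) x‖ ≤ ∑ i ∈ Finset.range (s + 1),
      (s.choose i : ℝ) * ‖iteratedFDeriv ℝ i f x‖ * ‖iteratedFDeriv ℝ (s - i) g x‖ := by
  obtain ⟨V, hV, hxV, hgV⟩ := hg.exists_isOpen_contDiffOn
  obtain ⟨U, hU, hxU, hfU⟩ := hf.exists_isOpen_contDiffOn
  have hW := hU.inter hV
  have hxW : x ∈ U ∩ V := ⟨hxU, hxV⟩
  have h := norm_iteratedFDerivWithin_clm_apply (n := s) (hfU.mono inter_subset_left)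
    (hgV.mono inter_subset_right) hW.uniqueDiffOn hxW le_rfl
  rw [iteratedFDerivWithin_of_isOpen s hW hxW] at h
  refine h.trans (le_of_eq (Finset.sum_congr rfl fun i _ => ?_))
  rw [iteratedFDerivWithin_of_isOpen i hW hxW, iteratedFDerivWithin_of_isOpen (s - i) hW hxW]

theorem ContDiffAt.exists_eventually_norm_iteratedFDeriv_le {f : E → F} {s : ℕ} {x : E}
    (hf : ContDiffAt ℝ s f x) :
    ∃ C : ℝ, 1 ≤ C ∧ ∀ᶠ u in 𝓝 x, ∀ i ≤ s, ‖iteratedFDeriv ℝ i f u‖ ≤ C := by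
  refine ⟨1 + ∑ i ∈ Finset.range (s + 1), (‖iteratedFDeriv ℝ i f x‖ + 1), ?_, ?_⟩
  · have : 0 ≤ ∑ i ∈ Finset.range (s + 1), (‖iteratedFDeriv ℝ i f x‖ + 1) :=
      Finset.sum_nonneg fun i _ => by positivity
    linarith
  have h : ∀ i : Fin (s + 1), ∀ᶠ u in 𝓝 x,
      ‖iteratedFDeriv ℝ i f u‖ < ‖iteratedFDeriv ℝ i f x‖ + 1 := by
    intro i
    have hc := (hf.continuousAt_iteratedFDeriv (k := i)
      (by exact_mod_cast Nat.lt_succ_iff.1 i.2)).norm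
    exact hc.eventually_lt continuousAt_const (by simp)
  filter_upwards [eventually_all.2 h] with u hu i hi
  have h1 := hu ⟨i, Nat.lt_succ_of_le hi⟩
  have h2 : ‖iteratedFDeriv ℝ i f x‖ + 1 ≤
      ∑ i ∈ Finset.range (s + 1), (‖iteratedFDeriv ℝ i f x‖ + 1) :=
    Finset.single_le_sum (f := fun i => ‖iteratedFDeriv ℝ i f x‖ + 1)
      (fun i _ => by positivity) (Finset.mem_range.2 (Nat.lt_succ_of_le hi))
  simp only at h1
  linarith

/-- The derivatives of `u ↦ Q(u) h(φ(u))` are bounded by those of `h`, locally uniformly. -/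
theorem exists_eventually_norm_iteratedFDeriv_clm_comp_le {E' : Type*} [NormedAddCommGroup E']
    [NormedSpace ℝ E'] {φ : E → E'} {Q : E → F →L[ℝ] G} {s : ℕ} {x : E}
    (hφ : ContDiffAt ℝ s φ x) (hQ : ContDiffAt ℝ s Q x) :
    ∃ C : ℝ, 0 ≤ C ∧ ∀ᶠ u in 𝓝 x, ∀ h : E' → F, ContDiffAt ℝ s h (φ u) → ∀ M : ℝ,
      (∀ i ≤ s, ‖iteratedFDeriv ℝ i h (φ u)‖ ≤ M) →
      ∀ j ≤ s, ‖iteratedFDeriv ℝ j (fun v => Q v (h (φ v))) u‖ ≤ C * M := by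
  obtain ⟨D, hD1, hD⟩ := hφ.exists_eventually_norm_iteratedFDeriv_le
  obtain ⟨B, hB1, hB⟩ := hQ.exists_eventually_norm_iteratedFDeriv_le
  have hs : (s : WithTop ℕ∞) ≠ ((⊤ : ℕ∞) : WithTop ℕ∞) := by
    intro h
    exact absurd (by exact_mod_cast h) (ENat.natCast_ne_top s)
  refine ⟨2 ^ s * B * (s.factorial * D ^ s), by positivity, ?_⟩
  filter_upwards [hD, hB, hφ.eventually hs, hQ.eventually hs] with u hDu hBu hφu hQu h hh M hM j hj
  have hM0 : 0 ≤ M := (norm_nonneg _).trans (hM 0 (Nat.zero_le _))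
  -- The composition contributes `s! * D ^ s` and the Leibniz rule `2 ^ s * B`. The normalization `1
  -- ≤ D` gives both `D ≤ D ^ l` for `1 ≤ l` and `D ^ i ≤ D ^ s`.
  have hcomp : ∀ i ≤ s, ‖iteratedFDeriv ℝ i (h ∘ φ) u‖ ≤ s.factorial * D ^ s * M := by
    intro i hi
    have hi' : (i : WithTop ℕ∞) ≤ s := by exact_mod_cast hi
    have h1 := norm_iteratedFDeriv_comp_le_of_contDiffAt (hh.of_le hi') (hφu.of_le hi')
      (fun l hl => hM l (hl.trans hi))
      (fun l hl1 hl => (hDu l (hl.trans hi)).trans (le_self_pow₀ hD1 (by omega)))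
    calc _ ≤ i.factorial * M * D ^ i := h1
      _ ≤ s.factorial * M * D ^ s := by
        gcongr
      _ = _ := by ring
  have hj' : (j : WithTop ℕ∞) ≤ s := by exact_mod_cast hj
  have h2 := norm_iteratedFDeriv_clm_apply_of_contDiffAt (g := h ∘ φ) (hQu.of_le hj')
    ((hh.comp u hφu).of_le hj')
  calc _ ≤ _ := h2
    _ ≤ ∑ i ∈ Finset.range (j + 1), (j.choose i : ℝ) * (B * (s.factorial * D ^ s * M)) := by
      refine Finset.sum_le_sum fun i hi => ?_
      have hi : i ≤ j := Nat.lt_succ_iff.1 (Finset.mem_range.1 hi)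
      rw [mul_assoc]
      gcongr
      · exact hBu i (hi.trans hj)
      · exact hcomp _ (by omega)
    _ = 2 ^ j * (B * (s.factorial * D ^ s * M)) := by
      rw [← Finset.sum_mul]
      congr 1
      exact_mod_cast Nat.sum_range_choose j
    _ ≤ 2 ^ s * (B * (s.factorial * D ^ s * M)) := by
      gcongr
      norm_num
    _ = _ := by ring

/-- The same bound, uniformly on a compact set. -/
theorem IsCompact.exists_norm_iteratedFDeriv_clm_apply_le {Q : E → F →L[ℝ] G} {s : ℕ} {K : Set E}
    (hK : IsCompact K) (hQ : ∀ x ∈ K, ContDiffAt ℝ s Q x) :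
    ∃ C : ℝ, 0 ≤ C ∧ ∀ u ∈ K, ∀ h : E → F, ContDiffAt ℝ s h u → ∀ M : ℝ,
      (∀ i ≤ s, ‖iteratedFDeriv ℝ i h u‖ ≤ M) →
      ∀ j ≤ s, ‖iteratedFDeriv ℝ j (fun v => Q v (h v)) u‖ ≤ C * M := by
  refine hK.induction_on (p := fun A => ∃ C : ℝ, 0 ≤ C ∧ ∀ u ∈ A, ∀ h : E → F,
      ContDiffAt ℝ s h u → ∀ M : ℝ, (∀ i ≤ s, ‖iteratedFDeriv ℝ i h u‖ ≤ M) →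
      ∀ j ≤ s, ‖iteratedFDeriv ℝ j (fun v => Q v (h v)) u‖ ≤ C * M) ?_ ?_ ?_ ?_
  · exact ⟨0, le_rfl, by simp⟩
  · rintro A B hAB ⟨C, hC, h⟩
    exact ⟨C, hC, fun u hu => h u (hAB hu)⟩
  · rintro A B ⟨C, hC, h⟩ ⟨C', hC', h'⟩
    refine ⟨max C C', le_max_of_le_left hC, ?_⟩
    intro u hu g hg M hM j hj
    have hM0 : 0 ≤ M := (norm_nonneg _).trans (hM 0 (Nat.zero_le _))
    rcases hu with hu | hu
    · exact (h u hu g hg M hM j hj).trans (by gcongr; exact le_max_left _ _)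
    · exact (h' u hu g hg M hM j hj).trans (by gcongr; exact le_max_right _ _)
  · intro x hx
    obtain ⟨C, hC, h⟩ := exists_eventually_norm_iteratedFDeriv_clm_comp_le (φ := id)
      contDiffAt_id (hQ x hx)
    exact ⟨_, mem_nhdsWithin_of_mem_nhds h, C, hC, fun u hu => hu⟩

end IteratedDerivatives

/-! ### Transfer of representatives from one chart to another -/

namespace CompleteOrbifoldMap.Transitions

variable {n m : ℕ} {r : ℕ∞} {X Y : Type*} [TopologicalSpace X] [TopologicalSpace Y]
  {O : Orbifold n (r + 1) X} {P : Orbifold m (r + 1) Y} {f : CompleteOrbifoldMap O P} {w z x : X}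

/-- The local representatives of all orbisections near `y` in the chart at `x` are obtained from those
near `y'` in the chart at `x'` by a `C^r` change of coordinates and of the bundle coordinates. -/
def Transfer (T : f.Transitions) (x : X) (y : Eu n) (x' : X) (y' : Eu n) : Prop :=
  ∃ (φ : Eu n → Eu n) (Q : Eu n → Eu m →L[ℝ] Eu m), ContDiffAt ℝ (r : WithTop ℕ∞) φ y ∧
    ContDiffAt ℝ (r : WithTop ℕ∞) Q y ∧ φ y = y' ∧
    ∀ᶠ u in 𝓝 y, ∀ σ : T.Orbisection r, σ.repr x u = Q u (σ.repr x' (φ u))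

theorem Transfer.trans {T : f.Transitions} {x x' x'' : X} {y y' y'' : Eu n}
    (h : T.Transfer x y x' y') (h' : T.Transfer x' y' x'' y'') : T.Transfer x y x'' y'' := by
  obtain ⟨φ, Q, hφ, hQ, rfl, he⟩ := h
  obtain ⟨φ', Q', hφ', hQ', rfl, he'⟩ := h'
  refine ⟨φ' ∘ φ, fun u => (Q u).comp (Q' (φ u)), hφ'.comp y hφ, hQ.clm_comp (hQ'.comp y hφ),
    rfl, ?_⟩
  filter_upwards [he, hφ.continuousAt.eventually he'] with u hu hu' σ
  rw [hu, hu']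
  rfl

theorem coe_le_coe_add_one (r : ℕ∞) : (r : WithTop ℕ∞) ≤ ((r + 1 : ℕ∞) : WithTop ℕ∞) := by
  exact_mod_cast le_self_add

theorem coe_add_one_le (r : ℕ∞) : (r : WithTop ℕ∞) + 1 ≤ ((r + 1 : ℕ∞) : WithTop ℕ∞) := by
  exact_mod_cast le_rfl

/-- Equivariance under `γ⁻¹` at the point `γ · u` expresses the value at `u`. The matrix function is
the differential of a C^(r+1) map along a lift, hence C^r. -/
theorem transfer_act (T : f.Transitions) (γ : (O.chart x).Γ) {y : Eu n} (hy : y ∈ f.dom x) :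
    T.Transfer x y x ((O.chart x).act γ y) := by
  have hγy := f.act_mem_dom γ hy
  have hact := ((O.chart x).contDiffAt_act γ (f.dom_subset x hy)).of_le (coe_le_coe_add_one r)
  refine ⟨(O.chart x).act γ, fun u => fderiv ℝ ((P.chart (f.toFun x)).act (f.Θ x γ⁻¹))
    (f.lift x ((O.chart x).act γ u)), hact, ?_, rfl, ?_⟩
  · have h1 := ((P.chart (f.toFun x)).contDiffAt_act (f.Θ x γ⁻¹)
      (f.mapsTo_lift x hγy)).fderiv_right (coe_add_one_le r)
    exact h1.comp y (((f.contDiffAt_lift hγy).of_le (coe_le_coe_add_one r)).comp y hact)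
  · filter_upwards [f.dom_mem_nhds hy] with u hu σ
    rw [← σ.repr_act γ⁻¹ (f.act_mem_dom γ hu), (O.chart x).act_inv_act γ (f.dom_subset x hu)]

theorem contDiffAt_fderiv_η_lift (T : f.Transitions) (hz : z ∈ f.base x) {y : Eu n}
    (hy : y ∈ f.dom z) (hyP : f.lift z y ∈ (P.ψ (f.toFun z) (f.toFun x)).source) :
    ContDiffAt ℝ (r : WithTop ℕ∞) (fun u => fderiv ℝ (T.η z x) (f.lift z u)) y :=
  ((T.contDiffAt_η hz hyP).fderiv_right (coe_add_one_le r)).comp y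
    ((f.contDiffAt_lift hy).of_le (coe_le_coe_add_one r))

theorem contDiffAt_fderiv_ηInv_lift (T : f.Transitions) (hz : z ∈ f.base x) {y : Eu n}
    (hy : y ∈ f.dom z) (hyP : f.lift z y ∈ (P.ψ (f.toFun z) (f.toFun x)).source) :
    ContDiffAt ℝ (r : WithTop ℕ∞)
      (fun u => fderiv ℝ (T.ηInv z x) (T.η z x (f.lift z u))) y := by
  have h1 := (T.contDiffAt_η hz hyP).of_le (coe_le_coe_add_one r)
  have h2 := (T.contDiffAt_ηInv hz hyP).fderiv_right (coe_add_one_le r)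
  have h3 := (f.contDiffAt_lift hy).of_le (coe_le_coe_add_one r)
  exact h2.comp y (h1.comp y h3)

theorem transfer_of_center (T : f.Transitions) (hz : z ∈ f.base x) :
    T.Transfer z (O.chart z).center x (O.ψ z x (O.chart z).center) := by
  have hsrc := O.center_mem_source z x (f.base_subset hz)
  have hc := f.center_mem_dom z
  have hP := f.lift_center_mem_source hz
  refine ⟨O.ψ z x, fun u => fderiv ℝ (T.ηInv z x) (T.η z x (f.lift z u)),
    (O.contDiffAt_ψ (f.base_subset hz) hsrc).of_le (coe_le_coe_add_one r),
    T.contDiffAt_fderiv_ηInv_lift hz hc hP, rfl, ?_⟩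
  filter_upwards [eventually_repr_ψ le_add_self T r hz, f.continuousAt_lift hc
    ((P.ψ (f.toFun z) (f.toFun x)).open_source.mem_nhds hP)] with u hu huP σ
  rw [hu σ, T.fderiv_ηInv_fderiv_η le_add_self hz huP]

theorem transfer_to_center (T : f.Transitions) (hz : z ∈ f.base x) :
    T.Transfer x (O.ψ z x (O.chart z).center) z (O.chart z).center := by
  have hsrc := O.center_mem_source z x (f.base_subset hz)
  have ht := (O.ψ z x).map_source hsrc
  have hinv := (O.ψ z x).left_inv hsrc
  have hc := f.center_mem_dom z
  have hP := f.lift_center_mem_source hz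
  have hφ := (O.contDiffAt_ψ_symm (f.base_subset hz) ht).of_le (coe_le_coe_add_one r)
  refine ⟨(O.ψ z x).symm, fun u => fderiv ℝ (T.η z x) (f.lift z ((O.ψ z x).symm u)), hφ, ?_,
    hinv, ?_⟩
  · have h := T.contDiffAt_fderiv_η_lift hz hc hP
    rw [← hinv] at h
    exact h.comp _ hφ
  · have h := (O.ψ z x).continuousAt_symm ht
    rw [ContinuousAt, hinv] at h
    filter_upwards [h.eventually (eventually_repr_ψ le_add_self T r hz),
      (O.ψ z x).open_target.mem_nhds ht] with u hu hut σ
    have := hu σ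
    rwa [(O.ψ z x).right_inv hut] at this

/-- The transfer passes through the centre w̃ over the common image `w`: a group element moves `y`
to ψ_wx(w̃), two chart changes lead over w̃ to ψ_wx'(w̃), and a group element leads to `y'`. -/
theorem transfer_of_proj_eq (T : f.Transitions) {x x' : X} {y y' : Eu n} (hy : y ∈ f.dom x)
    (hy' : y' ∈ f.dom x') (h : (O.chart x).proj y = (O.chart x').proj y') :
    T.Transfer x y x' y' := by
  obtain ⟨γ, hγ⟩ := f.exists_act_eq hy (f.ψ_center_mem_dom (f.proj_mem_base hy))
    (O.proj_ψ_center (f.base_subset (f.proj_mem_base hy))).symm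
  obtain ⟨γ', rfl⟩ := f.exists_act_ψ_center_eq hy' h.symm
  have hw' : (O.chart x).proj y ∈ f.base x' := h ▸ f.proj_mem_base hy'
  have h1 := T.transfer_act γ hy
  rw [hγ] at h1
  exact ((h1.trans (T.transfer_to_center (f.proj_mem_base hy))).trans
    (T.transfer_of_center hw')).trans (T.transfer_act γ' (f.ψ_center_mem_dom hw'))

end CompleteOrbifoldMap.Transitions

/-! ### Closed subspaces of products of Banach spaces -/

section ClosedSubspacesOfProducts

variable {ι : Type*} {G : ι → Type*} [∀ i, NormedAddCommGroup (G i)] [∀ i, NormedSpace ℝ (G i)]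
  {V : Type*} [AddCommGroup V] [Module ℝ V] [TopologicalSpace V] {L : V →ₗ[ℝ] ∀ i, G i}

theorem LinearMap.isTopologicalAddGroup_of_isInducing_pi (hL : IsInducing L) :
    IsTopologicalAddGroup V := by
  have := topologicalAddGroup_induced L
  rwa [← hL.eq_induced] at this

theorem LinearMap.continuousSMul_of_isInducing_pi (hL : IsInducing L) : ContinuousSMul ℝ V := by
  have := continuousSMul_induced (R := ℝ) L
  rwa [← hL.eq_induced] at this

theorem LinearMap.isFrechet_of_isClosedEmbedding_pi [Countable ι] [∀ i, CompleteSpace (G i)]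
    [IsTopologicalAddGroup V] (hL : IsClosedEmbedding L) : IsFrechet V := by
  refine ⟨?_, ?_, ?_⟩
  · have := LocallyConvexSpace.induced (𝕜 := ℝ) L
    rwa [← hL.eq_induced] at this
  · have : TopologicalSpace.MetrizableSpace (∀ i, G i) := UniformSpace.metrizableSpace
    exact hL.isEmbedding.metrizableSpace
  · let := IsTopologicalAddGroup.rightUniformSpace V
    have : IsUniformAddGroup V := isUniformAddGroup_of_addCommGroup
    have h : IsUniformInducing L := AddMonoidHom.isUniformInducing_of_isInducing hL.isInducing
    rw [completeSpace_iff_isComplete_range h]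
    exact hL.isClosed_range.isComplete

end ClosedSubspacesOfProducts

theorem LinearMap.isBanachable_of_isClosedEmbedding {V : Type*} [AddCommGroup V] [Module ℝ V]
    [TopologicalSpace V] {B : Type} [NormedAddCommGroup B] [NormedSpace ℝ B] [CompleteSpace B]
    {L : V →ₗ[ℝ] B} (hL : IsClosedEmbedding L) : IsBanachable V := by
  have hc : IsClosed (LinearMap.range L : Set B) := by
    rw [LinearMap.coe_range]
    exact hL.isClosed_range
  have : CompleteSpace (LinearMap.range L) := hc.completeSpace_coe
  let e : V ≃ₗ[ℝ] LinearMap.range L := LinearEquiv.ofInjective L hL.injective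
  have he : IsInducing e := by
    apply IsInducing.of_comp (g := Subtype.val) (f := e) _ continuous_subtype_val
    · exact hL.isInducing
    · exact Continuous.subtype_mk hL.continuous _
  let e' : V ≃L[ℝ] LinearMap.range L :=
    { e with
      continuous_toFun := he.continuous
      continuous_invFun := by
        rw [he.continuous_iff]
        convert continuous_id using 1
        funext x
        exact e.apply_symm_apply x }
  -- The range lies in the universe of `B`; `ULift` moves it to that of `V`, as `IsBanachable`
  -- demands.
  exact ⟨ULift (LinearMap.range L), inferInstance, inferInstance, inferInstance,
    ⟨e'.trans ContinuousLinearEquiv.ulift.symm⟩⟩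

section ContinuousMapProducts

variable {ι : Type*} {S : ι → Type*} [∀ i, TopologicalSpace (S i)] [∀ i, CompactSpace (S i)]
  {E : ι → Type*} [∀ i, NormedAddCommGroup (E i)] [∀ i, NormedSpace ℝ (E i)]
  {V : Type*} [AddCommGroup V] [Module ℝ V] [TopologicalSpace V] {L : V →ₗ[ℝ] ∀ i, C(S i, E i)}

/-- On a compact space the compact-open topology is that of the supremum norm, so the case of normed
factors applies. -/
theorem LinearMap.isTopologicalAddGroup_of_isInducing_continuousMap (hL : IsInducing L) :
    IsTopologicalAddGroup V :=
  LinearMap.isTopologicalAddGroup_of_isInducing_pi (G := fun i => C(S i, E i)) hL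

theorem LinearMap.continuousSMul_of_isInducing_continuousMap (hL : IsInducing L) : ContinuousSMul ℝ V :=
  LinearMap.continuousSMul_of_isInducing_pi (G := fun i => C(S i, E i)) hL

theorem LinearMap.isFrechet_of_isClosedEmbedding_continuousMap [Countable ι] [∀ i, CompleteSpace (E i)]
    [IsTopologicalAddGroup V] (hL : IsClosedEmbedding L) : IsFrechet V :=
  LinearMap.isFrechet_of_isClosedEmbedding_pi (G := fun i => C(S i, E i)) hL

end ContinuousMapProducts

theorem LinearMap.isBanachable_of_isClosedEmbedding_continuousMap {ι : Type} [Finite ι] {S : ι → Type}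
    [∀ i, TopologicalSpace (S i)] [∀ i, CompactSpace (S i)] {E : ι → Type}
    [∀ i, NormedAddCommGroup (E i)] [∀ i, NormedSpace ℝ (E i)] [∀ i, CompleteSpace (E i)]
    {V : Type*} [AddCommGroup V] [Module ℝ V] [TopologicalSpace V]
    {L : V →ₗ[ℝ] ∀ i, C(S i, E i)} (hL : IsClosedEmbedding L) : IsBanachable V := by
  have := Fintype.ofFinite ι
  exact LinearMap.isBanachable_of_isClosedEmbedding (B := ∀ i, C(S i, E i)) hL

/-- The algebraic multilinear maps form a finite-dimensional space, so this space is
finite-dimensional, hence proper and second countable. It serves to prove separability. -/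
theorem secondCountableTopology_continuousMultilinearMap (n m j : ℕ) :
    SecondCountableTopology (Eu n [×j]→L[ℝ] Eu m) := by
  have : FiniteDimensional ℝ (Eu n [×j]→L[ℝ] Eu m) :=
    Module.Finite.of_injective
      (⟨⟨ContinuousMultilinearMap.toMultilinearMap, fun _ _ => rfl⟩, fun _ _ => rfl⟩ :
        (Eu n [×j]→L[ℝ] Eu m) →ₗ[ℝ] MultilinearMap ℝ (fun _ : Fin j => Eu n) (Eu m))
      ContinuousMultilinearMap.toMultilinearMap_injective
  have := FiniteDimensional.proper ℝ (Eu n [×j]→L[ℝ] Eu m)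
  infer_instance

/-! ### Closedness of C^r(K, F) in the product of spaces of continuous maps -/

/-- The families of derivatives of elements of `C^r(K, F)` are closed under uniform convergence. -/
theorem isClosed_crSpace {n : ℕ} (r : ℕ∞) {K : Set (Eu n)} (hK : IsCompact K) (F : Type*)
    [NormedAddCommGroup F] [NormedSpace ℝ F] :
    IsClosed (CrSpace r K F : Set (∀ j : {j : ℕ // (j : ℕ∞) ≤ r},
      C(K, Eu n [×(j : ℕ)]→L[ℝ] F))) := by
  classical
  have : CompactSpace K := isCompact_iff_compactSpace.1 hK
  rw [← closure_subset_iff_isClosed]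
  intro J hJ
  let l := comap (Subtype.val : CrSpace r K F → _) (𝓝 J)
  have hl : l.NeBot := by
    rw [← mem_closure_iff_comap_neBot]
    exact hJ
  have ht : ∀ j, Tendsto (fun A : CrSpace r K F => A.1 j) l (𝓝 (J j)) := fun j =>
    (continuous_apply j).continuousAt.tendsto.comp tendsto_comap
  -- The families are extended by `0` off `K` and beyond order `r`, to become candidates for Taylor
  -- series of functions on ℝⁿ.
  let ext : (∀ j : {j : ℕ // (j : ℕ∞) ≤ r}, C(K, Eu n [×(j : ℕ)]→L[ℝ] F)) → Eu n →
      FormalMultilinearSeries ℝ (Eu n) F := fun A y j =>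
    if h : (j : ℕ∞) ≤ r ∧ y ∈ K then A ⟨j, h.1⟩ ⟨y, h.2⟩ else 0
  have hext : ∀ A (j : ℕ) (hj : (j : ℕ∞) ≤ r) (y : Eu n) (hy : y ∈ K),
      ext A y j = A ⟨j, hj⟩ ⟨y, hy⟩ := fun A j hj y hy => dif_pos ⟨hj, hy⟩
  have hsub : interior K ⊆ K := interior_subset
  have hunif : ∀ (j : ℕ), (j : ℕ∞) ≤ r →
      TendstoUniformlyOn (fun (A : CrSpace r K F) y => ext A.1 y j) (fun y => ext J y j) l
        (interior K) := by
    intro j hj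
    have h1 := ContinuousMap.tendsto_iff_tendstoUniformly.1 (ht ⟨j, hj⟩)
    rw [Metric.tendstoUniformly_iff] at h1
    rw [Metric.tendstoUniformlyOn_iff]
    intro ε hε
    filter_upwards [h1 ε hε] with A hA y hy
    rw [hext _ j hj y (hsub hy), hext _ j hj y (hsub hy)]
    exact hA ⟨y, hsub hy⟩
  have hderiv : ∀ (A : CrSpace r K F) (j : ℕ), ((j + 1 : ℕ) : ℕ∞) ≤ r → ∀ y ∈ interior K,
      HasFDerivAt (fun y => ext A.1 y j) ((ext A.1 y (j + 1)).curryLeft) y := by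
    intro A j hj y hy
    have hj' : (j : ℕ∞) ≤ r := le_trans (by exact_mod_cast Nat.le_succ j) hj
    obtain ⟨g, hg, hgA⟩ := A.2
    have he : (fun y => ext A.1 y j) =ᶠ[𝓝 y] iteratedFDeriv ℝ j g := by
      filter_upwards [isOpen_interior.mem_nhds hy] with u hu
      rw [hext _ j hj' u (hsub hu)]
      exact hgA ⟨j, hj'⟩ ⟨u, hsub hu⟩ hu
    have hd : DifferentiableAt ℝ (iteratedFDeriv ℝ j g) y := by
      have h1 := (hg.contDiffAt (isOpen_interior.mem_nhds hy)).iteratedFDeriv_right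
        (m := 1) (i := j) (by
          have : (1 : WithTop ℕ∞) + j = ((j + 1 : ℕ) : ℕ∞) := by push_cast; ring
          rw [this]
          exact_mod_cast hj)
      exact h1.differentiableAt one_ne_zero
    have h2 : (ext A.1 y (j + 1)).curryLeft = fderiv ℝ (iteratedFDeriv ℝ j g) y := by
      rw [hext _ (j + 1) hj y (hsub hy)]
      rw [hgA ⟨j + 1, hj⟩ ⟨y, hsub hy⟩ hy]
      ext v w
      rfl
    rw [h2]
    exact hd.hasFDerivAt.congr_of_eventuallyEq he
  have hcont : ∀ (j : ℕ), (j : ℕ∞) ≤ r → ContinuousOn (fun y => ext J y j) (interior K) := by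
    intro j hj
    rw [continuousOn_iff_continuous_domRestrict]
    have h1 : Continuous fun y : interior K => J ⟨j, hj⟩ ⟨y, hsub y.2⟩ :=
      (J ⟨j, hj⟩).continuous.comp (by fun_prop)
    convert h1 using 1
    funext y
    exact hext _ j hj y (hsub y.2)
  -- Uniform convergence of the derivatives of order `j + 1` permits differentiating the limit of
  -- those of order `j`. So the limits form a Taylor series of the term of order zero.
  have hT : HasFTaylorSeriesUpToOn (r : WithTop ℕ∞) (fun y => (ext J y 0).curry0) (ext J)
      (interior K) := by
    refine ⟨fun _ _ => rfl, fun j hj y hy => ?_, fun j hj => hcont j (by exact_mod_cast hj)⟩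
    have hj1 : ((j + 1 : ℕ) : ℕ∞) ≤ r := by
      have : (j : ℕ∞) < r := by exact_mod_cast hj
      exact_mod_cast Order.add_one_le_of_lt this
    have hj' : (j : ℕ∞) ≤ r := le_trans (by exact_mod_cast Nat.le_succ j) hj1
    apply HasFDerivAt.hasFDerivWithinAt
    refine hasFDerivAt_of_tendstoUniformlyOn (l := l) isOpen_interior
      (f := fun (A : CrSpace r K F) y => ext A.1 y j)
      (f' := fun (A : CrSpace r K F) y => (ext A.1 y (j + 1)).curryLeft)
      (g' := fun y => (ext J y (j + 1)).curryLeft) ?_ (fun A y hy => hderiv A j hj1 y hy) ?_ hy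
    · exact ((continuousMultilinearCurryLeftEquiv ℝ (fun _ : Fin (j + 1) => Eu n)
        F).isometry.uniformContinuous).comp_tendstoUniformlyOn (hunif (j + 1) hj1)
    · intro u hu
      exact (hunif j hj').tendsto_at hu
  refine ⟨_, hT.contDiffOn, fun j y hy => ?_⟩
  rw [← iteratedFDerivWithin_of_isOpen _ isOpen_interior hy,
    ← hT.eq_iteratedFDerivWithin_of_uniqueDiffOn (by exact_mod_cast j.2)
      isOpen_interior.uniqueDiffOn hy]
  exact (hext J j j.2 y y.2).symm

/-! ### The C^r topology in terms of derivatives on a finite cover -/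

namespace CompleteOrbifoldMap.Transitions

variable {n m : ℕ} {r : ℕ∞} {X Y : Type*} [TopologicalSpace X] [TopologicalSpace Y]
  {O : Orbifold n (r + 1) X} {P : Orbifold m (r + 1) Y} {f : CompleteOrbifoldMap O P}
  {T : f.Transitions} {w z x : X}

theorem changeDom_subset_dom : T.changeDom z x ⊆ f.dom z := fun _ hy =>
  hy.2.2.2.self_of_nhds.1

/-- Near the centre the self-change acts as a group element, so it preserves classes in the
quotient. Hence neighbourhoods `mapNhd` with `z = x` are available on small sets around the centre.
-/
theorem changeDom_self_mem_nhds (T : f.Transitions) (x : X) :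
    T.changeDom x x ∈ 𝓝 (O.chart x).center := by
  obtain ⟨δ, hδ⟩ := T.exists_bundleψ_self_eq x
  have hx := f.mem_base_self x
  have hc := f.center_mem_dom x
  filter_upwards [hδ.eventually_nhds, (f.dom_mem_nhds hc),
    (O.ψ x x).open_source.mem_nhds (O.center_mem_source x x (f.base_subset hx)),
    f.continuousAt_lift hc ((P.ψ (f.toFun x) (f.toFun x)).open_source.mem_nhds
      (f.lift_center_mem_source hx))] with y hy hyd hys hyP
  refine ⟨hys, hyP, hx, ?_⟩
  filter_upwards [hy, f.dom_mem_nhds hyd] with u hu hud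
  have h1 : O.ψ x x u = (O.chart x).act δ u := congrArg Prod.fst (hu 0)
  refine ⟨hud, h1 ▸ f.act_mem_dom δ hud, fun v => ?_⟩
  rw [← T.toTotal_bundleAct δ (q := (u, v)) hud (f.act_mem_dom δ hud)]
  congr 1
  exact (hu v).symm

theorem contDiffAt_bundleψ_comp (hz : z ∈ f.base x) {l : Eu n → Eu n × Eu m} {y : Eu n}
    (hl : ContDiffAt ℝ (r : WithTop ℕ∞) l y) (hs : (l y).1 ∈ (O.ψ z x).source)
    (hd : (l y).1 ∈ f.dom z) (hP : f.lift z (l y).1 ∈ (P.ψ (f.toFun z) (f.toFun x)).source) :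
    ContDiffAt ℝ (r : WithTop ℕ∞) (fun u => T.bundleψ z x (l u)) y := by
  have h1 : ContDiffAt ℝ (r : WithTop ℕ∞) (fun u => (l u).1) y := contDiffAt_fst.comp y hl
  have h2 : ContDiffAt ℝ (r : WithTop ℕ∞) (fun u => (l u).2) y := contDiffAt_snd.comp y hl
  refine ContDiffAt.prodMk ?_ ?_
  · exact ContDiffAt.comp (g := O.ψ z x) (f := fun u => (l u).1) y
      ((O.contDiffAt_ψ (f.base_subset hz) hs).of_le (coe_le_coe_add_one r)) h1
  · exact (ContDiffAt.comp (g := fun u => fderiv ℝ (T.η z x) (f.lift z u))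
      (f := fun u => (l u).1) y (T.contDiffAt_fderiv_η_lift hz hd hP) h1).clm_apply h2

theorem Orbisection.contDiffAt_repr (σ : T.Orbisection r) {y : Eu n} (hy : y ∈ f.dom x) :
    ContDiffAt ℝ (r : WithTop ℕ∞) (σ.repr x) y :=
  (σ.contDiffOn_repr x).contDiffAt (f.dom_mem_nhds hy)

theorem Orbisection.contDiffAt_bundleψ_repr (σ : T.Orbisection r) {y : Eu n}
    (hy : y ∈ T.changeDom x z) :
    ContDiffAt ℝ (r : WithTop ℕ∞) (fun u => T.bundleψ x z (u, σ.repr x u)) y :=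
  contDiffAt_bundleψ_comp hy.2.2.1 (l := fun u => (u, σ.repr x u))
    (contDiffAt_id.prodMk (σ.contDiffAt_repr (changeDom_subset_dom hy))) hy.1
    (changeDom_subset_dom hy) hy.2.1

/-- A lift over the chart at `x` of the map underlying an orbisection is the local representative of
the orbisection if this holds near the centre. -/
theorem Orbisection.eq_repr_of_lift (hr : 1 ≤ r) (σ : T.Orbisection r) {D : Set (Eu n)}
    (hD : (O.chart x).IsSubchart D) {l : Eu n → Eu n × Eu m} (hz : z = x)
    (hmaps : ∀ y ∈ D, (l y).1 ∈ f.dom z) (hl : ContDiffOn ℝ (r : WithTop ℕ∞) l D)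
    (htot : ∀ y, ∀ hy : y ∈ D, T.toTotal z (l y) (hmaps y hy) = σ.toFun ((O.chart x).proj y))
    (hgerm : ∀ᶠ y in 𝓝 (O.chart x).center, l y = (y, σ.repr x y)) :
    D ⊆ f.dom x ∧ ∀ y ∈ D, l y = (y, σ.repr x y) := by
  subst hz
  have hk : (1 : ℕ∞) ≤ r + 1 := le_add_self
  -- The first component covers the identity of the base and is the identity near the centre, so
  -- rigidity applies. The second component is then determined by the value in the quotient.
  have hid : ∀ y ∈ D, (l y).1 = y := by
    apply (O.chart z).eq_self_of_proj_eq hk hD.isOpen hD.isConnected.isPreconnected hD.subset_dom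
      (contDiff_fst.comp_contDiffOn (hl.of_le (by exact_mod_cast hr)))
      (fun y hy => f.dom_subset z (hmaps y hy)) _ hD.center_mem
    · filter_upwards [hgerm] with u hu
      rw [Function.comp_apply, hu]
    · intro y hy
      have h := congrArg T.bundleProj (htot y hy)
      rw [σ.bundleProj_toFun] at h
      exact h
  refine ⟨fun y hy => hid y hy ▸ hmaps y hy, fun y hy => ?_⟩
  have hy' : y ∈ f.dom z := hid y hy ▸ hmaps y hy
  have h2 : (l y).2 = σ.repr z y := by
    apply σ.eq_repr_of_toTotal_eq hk hy'
    rw [← htot y hy]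
    congr 1
    exact Prod.ext (hid y hy).symm rfl
  exact Prod.ext (hid y hy) h2

/-- The neighbourhoods of the `C^r` topology, on orbisections. -/
theorem Orbisection.toOrbMap_mem_mapNhd_iff (hr : 1 ≤ r) (σ : T.Orbisection r) (g₀ : T.MapRep r)
    (x z : X) (K : Set (Eu n)) (s : ℕ) (ε : ℝ) :
    Orbisection.toOrbMap T σ ∈ T.mapNhd g₀ x z K s ε ↔ K ⊆ f.dom x ∧ K ⊆ T.changeDom x z ∧
      ∀ j ≤ s, ∀ y ∈ K, ‖iteratedFDeriv ℝ j (fun u => T.bundleψ x z (u, σ.repr x u)) y -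
        iteratedFDeriv ℝ j (fun u => T.bundleψ (T.bundleProj (g₀.toFun x)) z (g₀.lift x u)) y‖
        < ε := by
  constructor
  · rintro ⟨g, hg, hKg, hch, hbd⟩
    -- The representative `g` may have other domains than `σ`, and only its germs at the centres are
    -- prescribed; its lifts nevertheless agree with those of `σ` throughout.
    obtain ⟨h1, h2⟩ : g.toFun = σ.toFun ∧
      ∀ x, g.lift x =ᶠ[𝓝 (O.chart x).center] fun y => (y, σ.repr x y) := Quotient.exact hg
    have hx : T.bundleProj (g.toFun x) = x := by rw [h1, σ.bundleProj_toFun]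
    obtain ⟨hd, hlift⟩ := σ.eq_repr_of_lift hr (g.isSubchart_dom x) hx (g.mapsTo_lift x)
      (g.contDiffOn_lift x) (fun y hy => (g.toTotal_lift x y hy).trans (by rw [h1])) (h2 x)
    refine ⟨hKg.trans hd, fun y hy => ?_, fun j hj y hy => ?_⟩
    · have := hch y hy
      rwa [hlift y (hKg hy), hx] at this
    · have h3 := hbd j hj y hy
      rw [hx] at h3
      have h4 : (fun u => T.bundleψ x z (g.lift x u)) =ᶠ[𝓝 y]
          fun u => T.bundleψ x z (u, σ.repr x u) := by
        filter_upwards [(g.isSubchart_dom x).isOpen.mem_nhds (hKg hy)] with u hu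
        rw [hlift u hu]
      rwa [(h4.iteratedFDeriv ℝ j).eq_of_nhds] at h3
  · rintro ⟨hKd, hch, hbd⟩
    refine ⟨Orbisection.toMapRep T σ, rfl, hKd, fun y hy => ?_, fun j hj y hy => ?_⟩
    · change y ∈ T.changeDom (T.bundleProj (σ.toFun x)) z
      rw [σ.bundleProj_toFun]
      exact hch hy
    · have := hbd j hj y hy
      change ‖iteratedFDeriv ℝ j (fun u => T.bundleψ (T.bundleProj (σ.toFun x)) z
        (u, σ.repr x u)) y - _‖ < ε
      rwa [σ.bundleProj_toFun]

/-- The derivatives of the local representative of an orbisection, on a subset of a chart. -/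
noncomputable def Orbisection.derivOn {K : Set (Eu n)} (hK : K ⊆ f.dom x)
    (j : {j : ℕ // (j : ℕ∞) ≤ r}) (σ : T.Orbisection r) : C(K, Eu n [×(j : ℕ)]→L[ℝ] Eu m) where
  toFun y := iteratedFDeriv ℝ (j : ℕ) (σ.repr x) y
  continuous_toFun := by
    rw [continuous_iff_continuousAt]
    intro y
    exact ContinuousAt.comp ((σ.contDiffAt_repr (hK y.2)).continuousAt_iteratedFDeriv
      (by exact_mod_cast j.2)) continuous_subtype_val.continuousAt

theorem natCast_le_coe {s : ℕ} (hs : (s : ℕ∞) ≤ r) : (s : WithTop ℕ∞) ≤ (r : WithTop ℕ∞) := by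
  exact_mod_cast hs

theorem Orbisection.bundleψ_repr_sub (σ τ : T.Orbisection r) (u : Eu n) :
    T.bundleψ x z (u, σ.repr x u) - T.bundleψ x z (u, τ.repr x u) =
      (0, fderiv ℝ (T.η x z) (f.lift x u) (σ.repr x u - τ.repr x u)) := by
  ext1
  · exact sub_self _
  · exact (map_sub _ _ _).symm

/-- The derivatives of the local representatives on a compact set where the chart at `x` has a chart
change to itself depend continuously on the orbisection. -/
theorem Orbisection.continuous_derivOn (hr : 1 ≤ r) {K : Set (Eu n)} (hKc : IsCompact K)
    (hK : K ⊆ f.dom x) (hch : K ⊆ T.changeDom x x) (j : {j : ℕ // (j : ℕ∞) ≤ r}) :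
    Continuous (Orbisection.derivOn (T := T) hK j) := by
  have : CompactSpace K := isCompact_iff_compactSpace.1 hKc
  obtain ⟨j, hj⟩ := j
  have hj' := natCast_le_coe hj
  rw [continuous_iff_continuousAt]
  intro σ₀
  refine (Metric.tendsto_nhds (α := C(K, Eu n [×j]→L[ℝ] Eu m))).2 fun ε hε => ?_
  have hx := f.mem_base_self x
  -- Inverts the fibre part of the self-change, so as to recover the difference of two
  -- representatives from their difference after the chart change.
  let Q : Eu n → (Eu n × Eu m) →L[ℝ] Eu m := fun u =>
    (fderiv ℝ (T.ηInv x x) (T.η x x (f.lift x u))).comp (ContinuousLinearMap.snd ℝ (Eu n) (Eu m))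
  have hQ : ∀ y ∈ K, ContDiffAt ℝ j Q y := fun y hy =>
    ((T.contDiffAt_fderiv_ηInv_lift hx (hK hy) (hch hy).2.1).clm_comp contDiffAt_const).of_le hj'
  obtain ⟨C, hC, hbound⟩ := hKc.exists_norm_iteratedFDeriv_clm_apply_le hQ
  have hε' : 0 < ε / (C + 1) := by positivity
  let N := T.mapNhd (Orbisection.toMapRep T σ₀) x x K j (ε / (C + 1))
  have hgen : IsOpen N := by
    refine TopologicalSpace.isOpen_generateFrom_of_mem ⟨Orbisection.toMapRep T σ₀, x, x, K, j, _,
      hKc, hK, fun y hy => ?_, hj, hε', rfl⟩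
    change y ∈ T.changeDom (T.bundleProj (σ₀.toFun x)) x
    rw [σ₀.bundleProj_toFun]
    exact hch hy
  have hN : ∀ σ : T.Orbisection r, Orbisection.toOrbMap T σ ∈ N ↔
      ∀ i ≤ j, ∀ y ∈ K, ‖iteratedFDeriv ℝ i (fun u => T.bundleψ x x (u, σ.repr x u)) y -
        iteratedFDeriv ℝ i (fun u => T.bundleψ x x (u, σ₀.repr x u)) y‖ < ε / (C + 1) := by
    intro σ
    rw [σ.toOrbMap_mem_mapNhd_iff hr]
    change _ ∧ _ ∧ (∀ j_1 ≤ j, ∀ y ∈ K, ‖_ - iteratedFDeriv ℝ j_1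
      (fun u => T.bundleψ (T.bundleProj (σ₀.toFun x)) x (u, σ₀.repr x u)) y‖ < _) ↔ _
    rw [σ₀.bundleProj_toFun]
    exact ⟨fun h => h.2.2, fun h => ⟨hK, hch, h⟩⟩
  have hmem : {σ | Orbisection.toOrbMap T σ ∈ N} ∈ 𝓝 σ₀ := by
    apply (isOpen_induced hgen).mem_nhds
    refine (hN σ₀).2 fun i _ y _ => ?_
    simpa using hε'
  filter_upwards [hmem] with σ hσ
  have hσ := (hN σ).1 hσ
  rw [ContinuousMap.dist_lt_iff hε]
  intro y
  have hyK := y.2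
  have hyd := hK hyK
  rw [dist_eq_norm]
  change ‖iteratedFDeriv ℝ j (σ.repr x) y - iteratedFDeriv ℝ j (σ₀.repr x) y‖ < ε
  rw [← iteratedFDeriv_sub_apply ((σ.contDiffAt_repr hyd).of_le hj')
    ((σ₀.contDiffAt_repr hyd).of_le hj')]
  let h : Eu n → Eu n × Eu m :=
    (fun u => T.bundleψ x x (u, σ.repr x u)) - (fun u => T.bundleψ x x (u, σ₀.repr x u))
  have h1 := (σ.contDiffAt_bundleψ_repr (hch hyK)).of_le hj'
  have h2 := (σ₀.contDiffAt_bundleψ_repr (hch hyK)).of_le hj'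
  have heq : σ.repr x - σ₀.repr x =ᶠ[𝓝 (y : Eu n)] fun u => Q u (h u) := by
    filter_upwards [f.continuousAt_lift hyd ((P.ψ (f.toFun x) (f.toFun x)).open_source.mem_nhds
      (hch hyK).2.1)] with u hu
    change _ = Q u (T.bundleψ x x (u, σ.repr x u) - T.bundleψ x x (u, σ₀.repr x u))
    rw [σ.bundleψ_repr_sub σ₀]
    exact (T.fderiv_ηInv_fderiv_η le_add_self hx hu _).symm
  rw [(heq.iteratedFDeriv ℝ j).eq_of_nhds]
  have h3 := hbound y hyK h (h1.sub h2) (ε / (C + 1)) (fun i hi => by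
    have hi' : (i : WithTop ℕ∞) ≤ j := by exact_mod_cast hi
    rw [iteratedFDeriv_sub_apply (h1.of_le hi') (h2.of_le hi')]
    exact (hσ i hi y hyK).le) j le_rfl
  calc _ ≤ C * (ε / (C + 1)) := h3
    _ < (C + 1) * (ε / (C + 1)) := by gcongr; linarith
    _ = ε := by field_simp

section Cover

variable {ι : Type*} {c : ι → X} {K : ι → Set (Eu n)}

/-- The derivatives of the local representatives of orbisections on compact subsets of charts are
bounded by those on the members of a cover. -/
theorem Orbisection.exists_norm_iteratedFDeriv_sub_le (hK : ∀ i, K i ⊆ f.dom (c i))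
    (hcov : ∀ w, ∃ i, ∃ y ∈ interior (K i), (O.chart (c i)).proj y = w) {A : Set (Eu n)}
    (hA : IsCompact A) (hAd : A ⊆ f.dom x) {s : ℕ} (hs : (s : ℕ∞) ≤ r) :
    ∃ C : ℝ, 0 ≤ C ∧ ∀ (σ τ : T.Orbisection r) (M : ℝ), 0 ≤ M →
      (∀ i, ∀ j ≤ s, ∀ y ∈ K i,
        ‖iteratedFDeriv ℝ j (σ.repr (c i)) y - iteratedFDeriv ℝ j (τ.repr (c i)) y‖ ≤ M) →
      ∀ j ≤ s, ∀ y ∈ A,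
        ‖iteratedFDeriv ℝ j (σ.repr x) y - iteratedFDeriv ℝ j (τ.repr x) y‖ ≤ C * M := by
  have hs' := natCast_le_coe hs
  refine hA.induction_on (p := fun A => ∃ C : ℝ, 0 ≤ C ∧ ∀ (σ τ : T.Orbisection r) (M : ℝ), 0 ≤ M →
      (∀ i, ∀ j ≤ s, ∀ y ∈ K i,
        ‖iteratedFDeriv ℝ j (σ.repr (c i)) y - iteratedFDeriv ℝ j (τ.repr (c i)) y‖ ≤ M) →
      ∀ j ≤ s, ∀ y ∈ A,
        ‖iteratedFDeriv ℝ j (σ.repr x) y - iteratedFDeriv ℝ j (τ.repr x) y‖ ≤ C * M) ?_ ?_ ?_ ?_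
  · exact ⟨0, le_rfl, by simp⟩
  · rintro A B hAB ⟨C, hC, h⟩
    exact ⟨C, hC, fun σ τ M hM hb j hj y hy => h σ τ M hM hb j hj y (hAB hy)⟩
  · rintro A B ⟨C, hC, h⟩ ⟨C', hC', h'⟩
    refine ⟨max C C', le_max_of_le_left hC, fun σ τ M hM hb j hj y hy => ?_⟩
    rcases hy with hy | hy
    · exact (h σ τ M hM hb j hj y hy).trans (by gcongr; exact le_max_left _ _)
    · exact (h' σ τ M hM hb j hj y hy).trans (by gcongr; exact le_max_right _ _)
  · intro y hy
    -- Near `y` the representatives are obtained by transfer from the interior of some `K i`. The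
    -- maps `φ` and `Q` do not depend on the section, so neither does the constant.
    obtain ⟨i, y', hy', hproj⟩ := hcov ((O.chart x).proj y)
    obtain ⟨φ, Q, hφ, hQ, rfl, he⟩ := T.transfer_of_proj_eq (hAd hy) (hK i (interior_subset hy'))
      hproj.symm
    obtain ⟨C, hC, hb⟩ := exists_eventually_norm_iteratedFDeriv_clm_comp_le (hφ.of_le hs')
      (hQ.of_le hs')
    have hint := hφ.continuousAt.eventually (isOpen_interior.mem_nhds hy')
    have hev := hb.and (hint.and (he.eventually_nhds.and (f.dom_mem_nhds (hAd hy))))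
    refine ⟨_, mem_nhdsWithin_of_mem_nhds hev, C, hC, fun σ τ M hM hbd j hj u hu => ?_⟩
    obtain ⟨hb, hint, he, hud⟩ := hu
    have hφK := interior_subset hint
    have hc1 := (σ.contDiffAt_repr (hK i hφK)).of_le hs'
    have hc2 := (τ.contDiffAt_repr (hK i hφK)).of_le hs'
    have hj' : (j : WithTop ℕ∞) ≤ s := by exact_mod_cast hj
    rw [← iteratedFDeriv_sub_apply ((σ.contDiffAt_repr hud).of_le (hj'.trans hs'))
      ((τ.contDiffAt_repr hud).of_le (hj'.trans hs'))]
    have heq : σ.repr x - τ.repr x =ᶠ[𝓝 u]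
        fun v => Q v ((σ.repr (c i) - τ.repr (c i)) (φ v)) := by
      filter_upwards [he] with v hv
      rw [Pi.sub_apply, Pi.sub_apply, map_sub, ← hv σ, ← hv τ]
    rw [(heq.iteratedFDeriv ℝ j).eq_of_nhds]
    refine hb (σ.repr (c i) - τ.repr (c i)) (hc1.sub hc2) M (fun l hl => ?_) j hj
    have hl' : (l : WithTop ℕ∞) ≤ s := by exact_mod_cast hl
    rw [iteratedFDeriv_sub_apply (hc1.of_le hl') (hc2.of_le hl')]
    exact hbd i l hl _ hφK

/-- The derivatives of all orders of the local representatives, on a family of subsets of charts. -/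
noncomputable def Orbisection.jets (hK : ∀ i, K i ⊆ f.dom (c i)) (σ : T.Orbisection r)
    (p : ι × {j : ℕ // (j : ℕ∞) ≤ r}) : C(K p.1, Eu n [×(p.2 : ℕ)]→L[ℝ] Eu m) :=
  σ.derivOn (hK p.1) p.2

/-- The comparison estimate with `s = 0` and `M = 0` gives equality at each point of each chart. -/
theorem Orbisection.jets_injective (hK : ∀ i, K i ⊆ f.dom (c i))
    (hcov : ∀ w, ∃ i, ∃ y ∈ interior (K i), (O.chart (c i)).proj y = w) :
    Function.Injective (Orbisection.jets (T := T) hK) := by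
  intro σ τ h
  apply Orbisection.repr_injective
  funext x y
  by_cases hy : y ∈ f.dom x
  · obtain ⟨C, -, hC⟩ := Orbisection.exists_norm_iteratedFDeriv_sub_le (T := T) hK hcov
      isCompact_singleton (singleton_subset_iff.2 hy) (s := 0) (by simp)
    have h1 := hC σ τ 0 le_rfl (fun i j hj u hu => by
      have hj : j = 0 := by omega
      subst hj
      have h2 := DFunLike.congr_fun (congrFun h (i, ⟨0, by simp⟩)) ⟨u, hu⟩
      change iteratedFDeriv ℝ 0 (σ.repr (c i)) u = iteratedFDeriv ℝ 0 (τ.repr (c i)) u at h2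
      rw [h2, sub_self, norm_zero]) 0 le_rfl y rfl
    rw [mul_zero, norm_le_zero_iff, sub_eq_zero] at h1
    have h3 := DFunLike.congr_fun h1 0
    simpa using h3
  · rw [σ.repr_eq_zero x y hy, τ.repr_eq_zero x y hy]

theorem exists_lt_forall_le_of_isCompact {E : Type*} [TopologicalSpace E] {A : Set E}
    (hA : IsCompact A) {g : E → ℝ} (hg : ContinuousOn g A) {ε : ℝ} (h : ∀ y ∈ A, g y < ε) :
    ∃ ε' < ε, ∀ y ∈ A, g y ≤ ε' := by
  rcases A.eq_empty_or_nonempty with rfl | hne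
  · exact ⟨ε - 1, by linarith, by simp⟩
  · obtain ⟨y, hy, hmax⟩ := hA.exists_isMaxOn hne hg
    exact ⟨g y, h y hy, fun u hu => hmax hu⟩

/-- The `C^r` topology on orbisections is that of uniform convergence of the derivatives on a finite
cover by compact subsets of charts. -/
theorem Orbisection.isInducing_jets [Finite ι] (hr : 1 ≤ r) (hKc : ∀ i, IsCompact (K i))
    (hK : ∀ i, K i ⊆ f.dom (c i)) (hch : ∀ i, K i ⊆ T.changeDom (c i) (c i))
    (hcov : ∀ w, ∃ i, ∃ y ∈ interior (K i), (O.chart (c i)).proj y = w) :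
    IsInducing (Orbisection.jets (T := T) hK) := by
  have hcomp : ∀ i, CompactSpace (K i) := fun i => isCompact_iff_compactSpace.1 (hKc i)
  refine ⟨le_antisymm ?_ ?_⟩
  · rw [← continuous_iff_le_induced]
    exact continuous_pi fun p =>
      Orbisection.continuous_derivOn hr (hKc p.1) (hK p.1) (hch p.1) p.2
  rw [instTopologicalSpaceOrbisection, ← continuous_iff_le_induced]
  refine continuous_generateFrom_iff.2 ?_
  rintro _ ⟨g₀, x, z, A, s, ε, hA, hAg₀, hg₀, hs, hε, rfl⟩
  have hs' := natCast_le_coe hs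
  let t : TopologicalSpace (T.Orbisection r) :=
    TopologicalSpace.induced (Orbisection.jets hK) inferInstance
  refine (@isOpen_iff_mem_nhds (T.Orbisection r) t _).2 fun σ hσ => ?_
  rw [nhds_induced]
  rw [mem_preimage, σ.toOrbMap_mem_mapNhd_iff hr] at hσ
  obtain ⟨hAd, hAch, hbd⟩ := hσ
  set G₀ := fun u => T.bundleψ (T.bundleProj (g₀.toFun x)) z (g₀.lift x u) with hG₀
  have hG₀s : ∀ y ∈ A, ContDiffAt ℝ (r : WithTop ℕ∞) G₀ y := fun y hy =>
    contDiffAt_bundleψ_comp (hg₀ y hy).2.2.1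
      ((g₀.contDiffOn_lift x).contDiffAt ((g₀.isSubchart_dom x).isOpen.mem_nhds (hAg₀ hy)))
      (hg₀ y hy).1 (changeDom_subset_dom (hg₀ y hy)) (hg₀ y hy).2.1
  -- Compactness of `A` turns the strict bounds into bounds with a common margin `ρ`, within which
  -- `σ` may be perturbed.
  have hgap : ∀ j : Fin (s + 1), ∃ ε' < ε, ∀ y ∈ A,
      ‖iteratedFDeriv ℝ j (fun u => T.bundleψ x z (u, σ.repr x u)) y - iteratedFDeriv ℝ j G₀ y‖
        ≤ ε' := by
    intro j
    have hj : (j : ℕ) ≤ s := Nat.lt_succ_iff.1 j.2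
    have hj' : ((j : ℕ) : WithTop ℕ∞) ≤ (r : WithTop ℕ∞) := le_trans (by exact_mod_cast hj) hs'
    refine exists_lt_forall_le_of_isCompact hA (fun y hy => ?_) (hbd j hj)
    exact ((((σ.contDiffAt_bundleψ_repr (hAch hy)).continuousAt_iteratedFDeriv hj').sub
      ((hG₀s y hy).continuousAt_iteratedFDeriv hj')).norm).continuousWithinAt
  choose ε' hε' hgap using hgap
  obtain ⟨ρ, hρ, hρε⟩ : ∃ ρ > 0, ∀ j, ε' j + ρ < ε := by
    have h1 : ∀ j, ∀ᶠ ρ in 𝓝[>] (0 : ℝ), ε' j + ρ < ε := fun j => by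
      have : ∀ᶠ ρ in 𝓝 (0 : ℝ), ρ < ε - ε' j := gt_mem_nhds (sub_pos.2 (hε' j))
      filter_upwards [nhdsWithin_le_nhds this] with ρ hρ
      linarith
    obtain ⟨ρ, h2, h3⟩ := ((eventually_all.2 h1).and self_mem_nhdsWithin).exists
    exact ⟨ρ, h3, h2⟩
  obtain ⟨C, hC, hCb⟩ := Orbisection.exists_norm_iteratedFDeriv_sub_le (T := T) hK hcov hA hAd hs
  -- After the chart change two orbisections differ only in the fibre, by this map applied to the
  -- difference of their representatives.
  let Q : Eu n → Eu m →L[ℝ] (Eu n × Eu m) := fun u =>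
    (ContinuousLinearMap.inr ℝ (Eu n) (Eu m)).comp (fderiv ℝ (T.η x z) (f.lift x u))
  have hQ : ∀ y ∈ A, ContDiffAt ℝ s Q y := fun y hy =>
    (contDiffAt_const.clm_comp (T.contDiffAt_fderiv_η_lift (hAch hy).2.2.1 (hAd hy)
      (hAch hy).2.1)).of_le hs'
  obtain ⟨C', hC', hCb'⟩ := hA.exists_norm_iteratedFDeriv_clm_apply_le hQ
  -- `C` is the cost of passing from the cover to `A`, and `C'` that of the chart change to `z`; the
  -- summand `1` avoids division by zero and makes `C' * (C * M) < ρ` strict.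
  set M := ρ / (C' * C + 1) with hM
  have hM0 : 0 < M := by positivity
  -- Only finitely many factors are constrained, as `ι` is finite and the orders are at most `s`; so
  -- this is a neighbourhood in the product topology even for infinite `r`.
  have hnear : ∀ᶠ J in 𝓝 (σ.jets hK), ∀ (i : ι) (j : Fin (s + 1)),
      dist (J (i, ⟨j, le_trans (by exact_mod_cast Nat.lt_succ_iff.1 j.2) hs⟩))
        (σ.jets hK (i, ⟨j, le_trans (by exact_mod_cast Nat.lt_succ_iff.1 j.2) hs⟩)) < M := by
    refine eventually_all.2 fun i => eventually_all.2 fun j => ?_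
    exact (Metric.tendsto_nhds (α := C(K i, Eu n [×(j : ℕ)]→L[ℝ] Eu m))).1
      ((continuous_apply _).tendsto (σ.jets hK)) M hM0
  filter_upwards [preimage_mem_comap hnear] with τ hτ
  rw [mem_preimage, τ.toOrbMap_mem_mapNhd_iff hr]
  refine ⟨hAd, hAch, fun j hj y hy => ?_⟩
  have hclose := hCb τ σ M hM0.le (fun i j hj y hy => by
    have h1 := hτ i ⟨j, Nat.lt_succ_of_le hj⟩
    rw [ContinuousMap.dist_lt_iff hM0] at h1
    have h2 := h1 ⟨y, hy⟩
    rw [dist_eq_norm] at h2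
    exact h2.le)
  have hj' : (j : WithTop ℕ∞) ≤ s := by exact_mod_cast hj
  have h1 := (τ.contDiffAt_bundleψ_repr (hAch hy)).of_le hs'
  have h2 := (σ.contDiffAt_bundleψ_repr (hAch hy)).of_le hs'
  have h3 := (τ.contDiffAt_repr (hAd hy)).of_le hs'
  have h4 := (σ.contDiffAt_repr (hAd hy)).of_le hs'
  have hdiff : ‖iteratedFDeriv ℝ j (fun u => T.bundleψ x z (u, τ.repr x u)) y -
      iteratedFDeriv ℝ j (fun u => T.bundleψ x z (u, σ.repr x u)) y‖ ≤ C' * (C * M) := by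
    rw [← iteratedFDeriv_sub_apply (h1.of_le hj') (h2.of_le hj')]
    have heq : (fun u => T.bundleψ x z (u, τ.repr x u)) - (fun u => T.bundleψ x z (u, σ.repr x u)) =
        fun u => Q u ((τ.repr x - σ.repr x) u) := by
      funext u
      exact τ.bundleψ_repr_sub σ u
    rw [heq]
    refine hCb' y hy (τ.repr x - σ.repr x) (h3.sub h4) (C * M) (fun i hi => ?_) j hj
    have hi' : (i : WithTop ℕ∞) ≤ s := by exact_mod_cast hi
    rw [iteratedFDeriv_sub_apply (h3.of_le hi') (h4.of_le hi')]
    exact hclose i hi y hy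
  have hlt : C' * (C * M) < ρ := by
    calc C' * (C * M) = (C' * C) * M := by ring
      _ < (C' * C + 1) * M := by gcongr; linarith
      _ = ρ := by rw [hM]; field_simp
  have h5 := hgap ⟨j, Nat.lt_succ_of_le hj⟩ y hy
  have h6 := hρε ⟨j, Nat.lt_succ_of_le hj⟩
  calc _ ≤ _ := norm_sub_le_norm_sub_add_norm_sub _
        (iteratedFDeriv ℝ j (fun u => T.bundleψ x z (u, σ.repr x u)) y) _
    _ < ρ + ε' ⟨j, Nat.lt_succ_of_le hj⟩ := add_lt_add_of_lt_of_le (hdiff.trans_lt hlt) h5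
    _ < ε := by linarith

end Cover

end CompleteOrbifoldMap.Transitions

/-! ### Closed range and the topological vector space structure -/

namespace CompleteOrbifoldMap.Transitions

variable {n m : ℕ} {r : ℕ∞} {X Y : Type*} [TopologicalSpace X] [TopologicalSpace Y]
  {O : Orbifold n (r + 1) X} {P : Orbifold m (r + 1) Y} {f : CompleteOrbifoldMap O P}
  {T : f.Transitions} {w z x : X}

section Cover

variable {ι : Type*} {c : ι → X} {K : ι → Set (Eu n)}

theorem Orbisection.derivOn_mem_crSpace {A : Set (Eu n)} (hA : A ⊆ f.dom x)
    (σ : T.Orbisection r) : (fun j => σ.derivOn hA j) ∈ CrSpace r A (Eu m) :=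
  ⟨σ.repr x, (σ.contDiffOn_repr x).mono (interior_subset.trans hA), fun _ _ _ => rfl⟩

/-- A limit of jets consists of the derivatives of C^r functions `g i` on the interiors of the `K
i`, by `isClosed_crSpace`. By transfer the representatives converge pointwise on every chart, to
functions locally of the form Q · (g i ∘ φ), which are C^r. Equivariance and compatibility are
linear with coefficients independent of the section, so they pass to the limit. Agreement of jets on
the interiors extends to `K i` by density. -/
theorem Orbisection.isClosed_range_jets (hKc : ∀ i, IsCompact (K i))
    (hKi : ∀ i, closure (interior (K i)) = K i) (hK : ∀ i, K i ⊆ f.dom (c i))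
    (hcov : ∀ w, ∃ i, ∃ y ∈ interior (K i), (O.chart (c i)).proj y = w) :
    IsClosed (range (Orbisection.jets (T := T) hK)) := by
  rw [← closure_subset_iff_isClosed]
  intro J hJ
  let F : Filter (T.Orbisection r) := comap (Orbisection.jets hK) (𝓝 J)
  have hF : F.NeBot := by
    rw [mem_closure_iff_comap_neBot] at hJ
    refine comap_neBot fun U hU => ?_
    obtain ⟨⟨_, σ, rfl⟩, hσ⟩ := hJ.nonempty_of_mem (preimage_mem_comap hU)
    exact ⟨σ, hσ⟩
  have ht : ∀ p, Tendsto (fun σ : T.Orbisection r => σ.jets hK p) F (𝓝 (J p)) := fun p =>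
    ((continuous_apply p).tendsto J).comp tendsto_comap
  have hJC : ∀ i, (fun j => J (i, j)) ∈ CrSpace r (K i) (Eu m) := by
    intro i
    refine (isClosed_crSpace r (hKc i) (Eu m)).mem_of_tendsto (b := F)
      (f := fun σ : T.Orbisection r => fun j => σ.jets hK (i, j))
      (tendsto_pi_nhds.2 fun j => ht (i, j)) (Eventually.of_forall fun σ => ?_)
    exact σ.derivOn_mem_crSpace (hK i)
  choose g hg hgJ using hJC
  have ht0 : ∀ i, ∀ y ∈ interior (K i),
      Tendsto (fun σ : T.Orbisection r => σ.repr (c i) y) F (𝓝 (g i y)) := by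
    intro i y hy
    have hyK := interior_subset hy
    have h1 : Tendsto (fun σ : T.Orbisection r => σ.jets hK (i, ⟨0, by simp⟩) ⟨y, hyK⟩ 0) F
        (𝓝 (J (i, ⟨0, by simp⟩) ⟨y, hyK⟩ 0)) := by
      have h2 : Tendsto (fun σ : T.Orbisection r => σ.jets hK (i, ⟨0, by simp⟩) ⟨y, hyK⟩) F
          (𝓝 (J (i, ⟨0, by simp⟩) ⟨y, hyK⟩)) :=
        ((ContinuousEvalConst.continuous_eval_const _).tendsto _).comp (ht (i, _))
      exact ((ContinuousMultilinearMap.apply ℝ (fun _ : Fin 0 => Eu n) (Eu m)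
        0).continuous.tendsto _).comp h2
    rw [hgJ i ⟨0, by simp⟩ ⟨y, hyK⟩ hy] at h1
    exact h1
  have hlim : ∀ x y, ∃ v, Tendsto (fun σ : T.Orbisection r => σ.repr x y) F (𝓝 v) := by
    intro x y
    by_cases hy : y ∈ f.dom x
    · obtain ⟨i, y', hy', hproj⟩ := hcov ((O.chart x).proj y)
      obtain ⟨φ, Q, -, -, rfl, he⟩ := T.transfer_of_proj_eq hy (hK i (interior_subset hy'))
        hproj.symm
      refine ⟨Q y (g i (φ y)), ?_⟩
      simp_rw [he.self_of_nhds]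
      exact ((Q y).continuous.tendsto _).comp (ht0 i _ hy')
    · refine ⟨0, ?_⟩
      simp_rw [fun σ : T.Orbisection r => σ.repr_eq_zero x y hy]
      exact tendsto_const_nhds
  choose s hs using hlim
  have hsg : ∀ i, ∀ y ∈ interior (K i), s (c i) y = g i y := fun i y hy =>
    tendsto_nhds_unique (hs _ _) (ht0 i y hy)
  have hmem : s ∈ T.sectionSpace r := by
    refine ⟨fun x y hy => ?_, fun x y hy => ?_, fun x γ y hy => ?_, fun w x hw => ?_⟩
    · refine tendsto_nhds_unique (hs x y) ?_
      simp_rw [fun σ : T.Orbisection r => σ.repr_eq_zero x y hy]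
      exact tendsto_const_nhds
    · obtain ⟨i, y', hy', hproj⟩ := hcov ((O.chart x).proj y)
      obtain ⟨φ, Q, hφ, hQ, rfl, he⟩ := T.transfer_of_proj_eq hy (hK i (interior_subset hy'))
        hproj.symm
      have heq : s x =ᶠ[𝓝 y] fun u => Q u (g i (φ u)) := by
        filter_upwards [he, hφ.continuousAt (isOpen_interior.mem_nhds hy')] with u hu huK
        refine tendsto_nhds_unique (hs x u) ?_
        simp_rw [hu]
        exact ((Q u).continuous.tendsto _).comp (ht0 i _ huK)
      exact ((hQ.clm_apply (((hg i).contDiffAt (isOpen_interior.mem_nhds hy')).comp y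
        hφ)).congr_of_eventuallyEq heq).contDiffWithinAt
    · refine tendsto_nhds_unique (hs x _) ?_
      simp_rw [fun σ : T.Orbisection r => σ.repr_act γ hy]
      exact ((ContinuousLinearMap.continuous _).tendsto _).comp (hs x y)
    · refine tendsto_nhds_unique (hs x _) ?_
      simp_rw [fun σ : T.Orbisection r => σ.repr_ψ_center le_add_self hw]
      exact ((ContinuousLinearMap.continuous _).tendsto _).comp (hs w _)
  refine ⟨sectionOf s hmem, ?_⟩
  funext ⟨i, j⟩
  have hdense : Dense {y : K i | (y : Eu n) ∈ interior (K i)} := by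
    rw [Subtype.dense_iff]
    intro y hy
    have himg : (Subtype.val '' {y : K i | (y : Eu n) ∈ interior (K i)}) = interior (K i) := by
      ext u
      exact ⟨fun ⟨v, hv, h⟩ => h ▸ hv, fun hu => ⟨⟨u, interior_subset hu⟩, hu, rfl⟩⟩
    rw [himg, hKi i]
    exact hy
  refine DFunLike.coe_injective (Continuous.ext_on hdense (ContinuousMap.continuous _)
    (ContinuousMap.continuous _) fun y hy => ?_)
  have heq : s (c i) =ᶠ[𝓝 (y : Eu n)] g i := by
    filter_upwards [isOpen_interior.mem_nhds hy] with u hu using hsg i u hu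
  exact ((heq.iteratedFDeriv ℝ j).eq_of_nhds).trans (hgJ i j y hy).symm

theorem Orbisection.derivOn_add [Add (T.Orbisection r)]
    (hadd : ∀ σ τ : T.Orbisection r, (σ + τ).repr = σ.repr + τ.repr)
    {A : Set (Eu n)} (hA : A ⊆ f.dom x) (j : {j : ℕ // (j : ℕ∞) ≤ r}) (σ τ : T.Orbisection r) :
    (σ + τ).derivOn hA j = σ.derivOn hA j + τ.derivOn hA j := by
  ext1 y
  change iteratedFDeriv ℝ (j : ℕ) ((σ + τ).repr x) y =
    iteratedFDeriv ℝ (j : ℕ) (σ.repr x) y + iteratedFDeriv ℝ (j : ℕ) (τ.repr x) y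
  rw [hadd, Pi.add_apply, iteratedFDeriv_add_apply
    ((σ.contDiffAt_repr (hA y.2)).of_le (natCast_le_coe j.2))
    ((τ.contDiffAt_repr (hA y.2)).of_le (natCast_le_coe j.2))]

theorem Orbisection.derivOn_smul [SMul ℝ (T.Orbisection r)]
    (hsmul : ∀ (a : ℝ) (σ : T.Orbisection r), (a • σ).repr = a • σ.repr)
    {A : Set (Eu n)} (hA : A ⊆ f.dom x) (j : {j : ℕ // (j : ℕ∞) ≤ r}) (a : ℝ) (σ : T.Orbisection r) :
    (a • σ).derivOn hA j = a • σ.derivOn hA j := by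
  ext1 y
  change iteratedFDeriv ℝ (j : ℕ) ((a • σ).repr x) y = a • iteratedFDeriv ℝ (j : ℕ) (σ.repr x) y
  rw [hsmul, Pi.smul_apply, iteratedFDeriv_const_smul_apply
    ((σ.contDiffAt_repr (hA y.2)).of_le (natCast_le_coe j.2))]

/-- The family of derivatives of the local representatives, as a linear map. -/
noncomputable def Orbisection.jetsLinear [AddCommGroup (T.Orbisection r)]
    [Module ℝ (T.Orbisection r)]
    (hadd : ∀ σ τ : T.Orbisection r, (σ + τ).repr = σ.repr + τ.repr)
    (hsmul : ∀ (a : ℝ) (σ : T.Orbisection r), (a • σ).repr = a • σ.repr) (hK : ∀ i, K i ⊆ f.dom (c i)) :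
    T.Orbisection r →ₗ[ℝ]
      ∀ p : ι × {j : ℕ // (j : ℕ∞) ≤ r}, C(K p.1, Eu n [×(p.2 : ℕ)]→L[ℝ] Eu m) where
  toFun := Orbisection.jets hK
  map_add' σ τ := funext fun p => Orbisection.derivOn_add hadd (hK p.1) p.2 σ τ
  map_smul' a σ := funext fun p => Orbisection.derivOn_smul hsmul (hK p.1) p.2 a σ

/-- `jets` is `L` followed by the continuous injection `E` that forgets the subspaces and regroups
the indices; its properties therefore pass to `L`. -/
theorem Orbisection.exists_isClosedEmbedding_crSpace [AddCommGroup (T.Orbisection r)]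
    [Module ℝ (T.Orbisection r)]
    (hadd : ∀ σ τ : T.Orbisection r, (σ + τ).repr = σ.repr + τ.repr)
    (hsmul : ∀ (a : ℝ) (σ : T.Orbisection r), (a • σ).repr = a • σ.repr) (hK : ∀ i, K i ⊆ f.dom (c i))
    (hJ : IsClosedEmbedding (Orbisection.jets (T := T) hK)) :
    ∃ L : T.Orbisection r →L[ℝ] (∀ i, CrSpace r (K i) (Eu m)), IsClosedEmbedding L ∧
      ∀ (σ : T.Orbisection r) (i : ι) (j : {j : ℕ // (j : ℕ∞) ≤ r}) (y : K i),
        (L σ i).1 j y = iteratedFDeriv ℝ (j : ℕ) (σ.repr (c i)) y := by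
  let L : T.Orbisection r →L[ℝ] (∀ i, CrSpace r (K i) (Eu m)) :=
    { toFun := fun σ i => ⟨fun j => σ.derivOn (hK i) j, σ.derivOn_mem_crSpace (hK i)⟩
      map_add' := fun σ τ => funext fun i => Subtype.ext (funext fun j =>
        Orbisection.derivOn_add hadd (hK i) j σ τ)
      map_smul' := fun a σ => funext fun i => Subtype.ext (funext fun j =>
        Orbisection.derivOn_smul hsmul (hK i) j a σ)
      cont := continuous_pi fun i => Continuous.subtype_mk (continuous_pi fun j =>
        (continuous_apply (i, j)).comp hJ.continuous) _ }
  let E : (∀ i, CrSpace r (K i) (Eu m)) →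
      ∀ p : ι × {j : ℕ // (j : ℕ∞) ≤ r}, C(K p.1, Eu n [×(p.2 : ℕ)]→L[ℝ] Eu m) :=
    fun A p => (A p.1).1 p.2
  have hE : Continuous E := continuous_pi fun p =>
    (continuous_apply p.2).comp (continuous_subtype_val.comp (continuous_apply p.1))
  have hEi : Function.Injective E := fun A B h =>
    funext fun i => Subtype.ext (funext fun j => congrFun h (i, j))
  have hEL : E ∘ L = Orbisection.jets hK := rfl
  refine ⟨L, ⟨⟨IsInducing.of_comp L.continuous hE (hEL ▸ hJ.isInducing), ?_⟩, ?_⟩,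
    fun _ _ _ _ => rfl⟩
  · exact Function.Injective.of_comp (f := E) (hEL ▸ hJ.injective)
  · have hr : range L = E ⁻¹' range (Orbisection.jets (T := T) hK) := by
      rw [← hEL, range_comp, preimage_image_eq _ hEi]
    rw [hr]
    exact hJ.isClosed_range.preimage hE

theorem Orbisection.isTopologicalVectorSpace [AddCommGroup (T.Orbisection r)]
    [Module ℝ (T.Orbisection r)]
    (hadd : ∀ σ τ : T.Orbisection r, (σ + τ).repr = σ.repr + τ.repr)
    (hsmul : ∀ (a : ℝ) (σ : T.Orbisection r), (a • σ).repr = a • σ.repr)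
    (hKc : ∀ i, IsCompact (K i)) (hK : ∀ i, K i ⊆ f.dom (c i))
    (hJ : IsInducing (Orbisection.jets (T := T) hK)) :
    IsTopologicalAddGroup (T.Orbisection r) ∧ ContinuousSMul ℝ (T.Orbisection r) := by
  have hcomp : ∀ i, CompactSpace (K i) := fun i => isCompact_iff_compactSpace.1 (hKc i)
  exact ⟨LinearMap.isTopologicalAddGroup_of_isInducing_continuousMap
    (L := Orbisection.jetsLinear hadd hsmul hK) hJ,
    LinearMap.continuousSMul_of_isInducing_continuousMap
      (L := Orbisection.jetsLinear hadd hsmul hK) hJ⟩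

/-- The target of `jets` is a countable product of second countable spaces. Second countability,
unlike separability, is inherited along any inducing map. -/
theorem Orbisection.separableSpace [Finite ι] (hKc : ∀ i, IsCompact (K i))
    (hK : ∀ i, K i ⊆ f.dom (c i)) (hJ : IsInducing (Orbisection.jets (T := T) hK)) :
    TopologicalSpace.SeparableSpace (T.Orbisection r) := by
  have hcomp : ∀ i, CompactSpace (K i) := fun i => isCompact_iff_compactSpace.1 (hKc i)
  have hsec : ∀ p : ι × {j : ℕ // (j : ℕ∞) ≤ r},
      SecondCountableTopology C(K p.1, Eu n [×(p.2 : ℕ)]→L[ℝ] Eu m) := fun p => by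
    have := secondCountableTopology_continuousMultilinearMap n m p.2
    infer_instance
  have := hJ.secondCountableTopology
  infer_instance

theorem Orbisection.isFrechet [Finite ι] [AddCommGroup (T.Orbisection r)]
    [Module ℝ (T.Orbisection r)]
    (hadd : ∀ σ τ : T.Orbisection r, (σ + τ).repr = σ.repr + τ.repr)
    (hsmul : ∀ (a : ℝ) (σ : T.Orbisection r), (a • σ).repr = a • σ.repr)
    [IsTopologicalAddGroup (T.Orbisection r)] (hKc : ∀ i, IsCompact (K i))
    (hK : ∀ i, K i ⊆ f.dom (c i)) (hJ : IsClosedEmbedding (Orbisection.jets (T := T) hK)) :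
    IsFrechet (T.Orbisection r) := by
  have hcomp : ∀ i, CompactSpace (K i) := fun i => isCompact_iff_compactSpace.1 (hKc i)
  exact LinearMap.isFrechet_of_isClosedEmbedding_continuousMap
    (L := Orbisection.jetsLinear hadd hsmul hK) hJ

/-- For finite `r` only finitely many orders occur, so the target is a finite product of Banach
spaces. -/
theorem Orbisection.isBanachable {ι : Type} [Finite ι] {c : ι → X} {K : ι → Set (Eu n)}
    [AddCommGroup (T.Orbisection r)]
    [Module ℝ (T.Orbisection r)]
    (hadd : ∀ σ τ : T.Orbisection r, (σ + τ).repr = σ.repr + τ.repr)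
    (hsmul : ∀ (a : ℝ) (σ : T.Orbisection r), (a • σ).repr = a • σ.repr)
    (hrt : r ≠ ⊤) (hKc : ∀ i, IsCompact (K i)) (hK : ∀ i, K i ⊆ f.dom (c i))
    (hJ : IsClosedEmbedding (Orbisection.jets (T := T) hK)) :
    IsBanachable (T.Orbisection r) := by
  have hcomp : ∀ i, CompactSpace (K i) := fun i => isCompact_iff_compactSpace.1 (hKc i)
  have : Finite {j : ℕ // (j : ℕ∞) ≤ r} := by
    obtain ⟨s, rfl⟩ := ENat.ne_top_iff_exists.1 hrt
    exact Set.Finite.subset (Set.finite_Iic s) fun j (hj : (j : ℕ∞) ≤ s) =>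
      Set.mem_Iic.2 (by exact_mod_cast hj)
  exact LinearMap.isBanachable_of_isClosedEmbedding_continuousMap
    (L := Orbisection.jetsLinear hadd hsmul hK) hJ

end Cover

/-! ### A finite cover by compact invariant sets -/

/-- Each point is the centre of a compact invariant subset of a chart, with a chart change of the chart
to itself. -/
theorem exists_isCompact_invariant (T : f.Transitions) (x : X) :
    ∃ K : Set (Eu n), IsCompact K ∧ closure (interior K) = K ∧ K ⊆ f.dom x ∧
      (∀ γ, MapsTo ((O.chart x).act γ) K K) ∧ K ⊆ T.changeDom x x ∧
      (O.chart x).center ∈ interior K := by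
  have hc := (O.chart x).center_mem
  have hev : ∀ᶠ u in 𝓝 (O.chart x).center, u ∈ (O.chart x).dom ∧
      ∀ γ, (O.chart x).act γ u ∈ T.changeDom x x := by
    refine Eventually.and ((O.chart x).isOpen_dom.mem_nhds hc) (eventually_all.2 fun γ => ?_)
    have h := (O.chart x).continuousAt_act γ hc
    rw [ContinuousAt, (O.chart x).act_center] at h
    exact h (T.changeDom_self_mem_nhds x)
  obtain ⟨ρ, hρ, hball⟩ := Metric.nhds_basis_closedBall.mem_iff.1 hev
  set B := Metric.closedBall (O.chart x).center ρ with hB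
  set U := Metric.ball (O.chart x).center ρ with hU
  have hBd : B ⊆ (O.chart x).dom := fun u hu => (hball hu).1
  have hUB : U ⊆ B := Metric.ball_subset_closedBall
  have hact : ∀ γ, ContinuousOn ((O.chart x).act γ) B := fun γ =>
    ((O.chart x).contDiffOn_act γ).continuousOn.mono hBd
  -- The union of all translates of a ball is invariant. It is the closure of its interior, since
  -- each translate is the image of the closure of an open ball whose translate is open.
  set K := ⋃ γ, (O.chart x).act γ '' B with hKdef
  have hKc : IsCompact K := isCompact_iUnion fun γ =>
    (isCompact_closedBall _ _).image_of_continuousOn (hact γ)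
  have hopen : ∀ γ, IsOpen ((O.chart x).act γ '' U) := by
    intro γ
    have h1 : (O.chart x).act γ '' U = (O.chart x).dom ∩ (O.chart x).act γ⁻¹ ⁻¹' U := by
      ext u
      constructor
      · rintro ⟨v, hv, rfl⟩
        refine ⟨(O.chart x).mapsTo_act γ (hBd (hUB hv)), ?_⟩
        rw [mem_preimage, (O.chart x).act_inv_act γ (hBd (hUB hv))]
        exact hv
      · rintro ⟨hu, hu'⟩
        exact ⟨_, hu', (O.chart x).act_act_inv γ hu⟩
    rw [h1]
    exact ((O.chart x).contDiffOn_act γ⁻¹).continuousOn.isOpen_inter_preimage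
      (O.chart x).isOpen_dom Metric.isOpen_ball
  have hUK : ∀ γ, (O.chart x).act γ '' U ⊆ interior K := fun γ =>
    interior_maximal ((image_mono hUB).trans (subset_iUnion_of_subset γ subset_rfl)) (hopen γ)
  have hKch : K ⊆ T.changeDom x x := by
    refine iUnion_subset fun γ => ?_
    rintro _ ⟨u, hu, rfl⟩
    exact (hball hu).2 γ
  refine ⟨K, hKc, ?_, hKch.trans changeDom_subset_dom, ?_, hKch, ?_⟩
  · refine (closure_minimal interior_subset hKc.isClosed).antisymm (iUnion_subset fun γ => ?_)
    have hcl : closure U = B := closure_ball _ hρ.ne'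
    rw [← hcl]
    refine ((hcl.symm ▸ hact γ : ContinuousOn _ (closure U)).image_closure).trans
      (closure_mono (hUK γ))
  · intro δ u hu
    obtain ⟨γ, v, hv, rfl⟩ := mem_iUnion.1 hu
    exact mem_iUnion.2 ⟨δ * γ, v, hv, (O.chart x).act_mul δ γ v (hBd hv)⟩
  · exact hUK 1 ⟨_, Metric.mem_ball_self hρ, (O.chart x).act_center 1⟩

/-- The images of the interiors are required to cover, because transfer compares representatives on
neighbourhoods, not only at points. -/
theorem exists_finite_cover [CompactSpace X] (T : f.Transitions) :
    ∃ (N : ℕ) (c : Fin N → X) (K : Fin N → Set (Eu n)),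
      (∀ i, IsCompact (K i) ∧ closure (interior (K i)) = K i ∧ K i ⊆ f.dom (c i) ∧
        (∀ γ, MapsTo ((O.chart (c i)).act γ) (K i) (K i)) ∧ K i ⊆ T.changeDom (c i) (c i)) ∧
      ∀ w, ∃ i, ∃ y ∈ interior (K i), (O.chart (c i)).proj y = w := by
  choose K h1 h2 h3 h4 h5 h6 using T.exists_isCompact_invariant
  have hnhds : ∀ x, (O.chart x).proj '' interior (K x) ∈ 𝓝 x := fun x =>
    ((O.chart x).isOpen_image_proj _ (interior_subset.trans ((h3 x).trans (f.dom_subset x)))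
      isOpen_interior).mem_nhds ⟨_, h6 x, (O.chart x).proj_center⟩
  obtain ⟨t, ht⟩ := CompactSpace.elim_nhds_subcover _ hnhds
  refine ⟨t.card, fun i => t.equivFin.symm i, fun i => K (t.equivFin.symm i),
    fun i => ⟨h1 _, h2 _, h3 _, h4 _, h5 _⟩, fun w => ?_⟩
  have hw : w ∈ ⋃ x ∈ t, (O.chart x).proj '' interior (K x) := by rw [ht]; trivial
  obtain ⟨x, hx, y, hy, rfl⟩ := mem_iUnion₂.1 hw
  have h : ∀ q : t, q = ⟨x, hx⟩ →
      ∃ y' ∈ interior (K q), (O.chart (q : X)).proj y' = (O.chart x).proj y := by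
    rintro _ rfl
    exact ⟨y, hy, rfl⟩
  exact ⟨t.equivFin ⟨x, hx⟩, h _ (Equiv.symm_apply_apply _ _)⟩

end CompleteOrbifoldMap.Transitions

/-! ### The main theorem -/

open CompleteOrbifoldMap Transitions in
theorem proposition5p6 {n m : ℕ} {X Y : Type*}
    [TopologicalSpace X] [T2Space X] [CompactSpace X]
    [TopologicalSpace Y] [T2Space Y] [ParacompactSpace Y]
    (r : ℕ∞) (hr : 1 ≤ r) (O : Orbifold n (r + 1) X) (P : Orbifold m (r + 1) Y)
    (f : CompleteOrbifoldMap O P) (T : f.Transitions) :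
    ∃ (_ : AddCommGroup (T.Orbisection r)) (_ : Module ℝ (T.Orbisection r))
      (_ : IsTopologicalAddGroup (T.Orbisection r)) (_ : ContinuousSMul ℝ (T.Orbisection r)),
      (∀ (σ τ : T.Orbisection r) (x : X) (y : Eu n),
        (σ + τ).repr x y = σ.repr x y + τ.repr x y) ∧
      (∀ (a : ℝ) (σ : T.Orbisection r) (x : X) (y : Eu n),
        (a • σ).repr x y = a • σ.repr x y) ∧
      TopologicalSpace.SeparableSpace (T.Orbisection r) ∧
      (r ≠ ⊤ → IsBanachable (T.Orbisection r)) ∧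
      (r = ⊤ → IsFrechet (T.Orbisection r)) ∧
      ∃ (N : ℕ) (c : Fin N → X) (K : Fin N → Set (Eu n)),
        (∀ i, IsCompact (K i) ∧ closure (interior (K i)) = K i ∧ K i ⊆ f.dom (c i) ∧
          ∀ γ, Set.MapsTo ((O.chart (c i)).act γ) (K i) (K i)) ∧
        (⋃ i, (O.chart (c i)).proj '' K i) = Set.univ ∧
        ∃ L : T.Orbisection r →L[ℝ] (∀ i, CrSpace r (K i) (Eu m)),
          Topology.IsClosedEmbedding L ∧
          ∀ (σ : T.Orbisection r) (i : Fin N) (j : {j : ℕ // (j : ℕ∞) ≤ r}) (y : K i),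
            (L σ i).1 j y = iteratedFDeriv ℝ (j : ℕ) (σ.repr (c i)) y := by
  obtain ⟨N, c, K, hprop, hcov⟩ := T.exists_finite_cover
  have hKc := fun i => (hprop i).1
  have hKi := fun i => (hprop i).2.1
  have hK := fun i => (hprop i).2.2.1
  have hinv := fun i => (hprop i).2.2.2.1
  have hch := fun i => (hprop i).2.2.2.2
  -- The structure is transported from `sectionSpace`, so that the operations on representatives are
  -- the pointwise ones by definition.
  obtain ⟨instG, instM, hadd, hsmul⟩ : ∃ (_ : AddCommGroup (T.Orbisection r))
      (_ : Module ℝ (T.Orbisection r)),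
      (∀ σ τ : T.Orbisection r, (σ + τ).repr = σ.repr + τ.repr) ∧
      ∀ (a : ℝ) (σ : T.Orbisection r), (a • σ).repr = a • σ.repr :=
    let e := T.orbisectionEquiv le_add_self r
    ⟨e.addCommGroup, e.module ℝ, fun _ _ => rfl, fun _ _ => rfl⟩
  have hind : IsInducing (Orbisection.jets (T := T) hK) := Orbisection.isInducing_jets hr hKc hK hch hcov
  have hJ : IsClosedEmbedding (Orbisection.jets (T := T) hK) :=
    ⟨⟨hind, Orbisection.jets_injective hK hcov⟩, Orbisection.isClosed_range_jets hKc hKi hK hcov⟩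
  obtain ⟨hT, hS⟩ := Orbisection.isTopologicalVectorSpace hadd hsmul hKc hK hind
  refine ⟨instG, instM, hT, hS, fun σ τ x y => by rw [hadd]; rfl,
    fun a σ x y => by rw [hsmul]; rfl, Orbisection.separableSpace hKc hK hind,
    fun hrt => Orbisection.isBanachable hadd hsmul hrt hKc hK hJ,
    fun _ => Orbisection.isFrechet hadd hsmul hKc hK hJ, N, c, K,
    fun i => ⟨hKc i, hKi i, hK i, hinv i⟩, ?_,
    Orbisection.exists_isClosedEmbedding_crSpace hadd hsmul hK hJ⟩
  refine eq_univ_of_forall fun w => ?_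
  obtain ⟨i, y, hy, rfl⟩ := hcov w
  exact mem_iUnion.2 ⟨i, y, interior_subset hy, rfl⟩
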